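/- Let $\Gamma$ be a discrete group with a measure preserving action on a probability space $(X,\mu)$, let $\pi\colon\Gamma\to O(H)$ be an orthogonal representation on a separable real Hilbert space $H$, and let $b\colon\Gamma\to H$ be a 1-cocycle, i.e. $b(gh)=\pi(g)b(h)+b(g)$ for all $g,h\in\Gamma$. Put $A=L^\infty(X,\mu)$. Fix an orthonormal basis $(e_n)_n$ of $H$, let $(Z,\nu)=\prod_n\big(\mathbb R,\tfrac1{\sqrt{2\pi}}e^{-x^2/2}dx\big)$, and for $\xi=\sum_n c_ne_n\in H$ let $\omega(\xi)\in L^\infty(Z,\nu)$ be the unitary $\omega(\xi)(z)=\exp\big(\sqrt2\,i\sum_n c_nz_n\big)$, where the sum converges in $L^2(Z,\nu)$. Let $D=\{\omega(\xi):\xi\in H\}''\subseteq L^\infty(Z,\nu)$, with the Gaussian action of $\Gamma$, determined by $g\cdot\omega(\xi)=\omega(\pi(g)\xi)$. Let $\tilde M=(D\bar\otimes A)\rtimes\Gamma$ be the von Neumann algebraic crossed product by the diagonal action, with canonical unitaries $u_g$ ($g\in\Gamma$), canonical trace $\tau\big(\sum_g x_gu_g\big)=\int x_e\,d(\nu\times\mu)$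 and 2-norm $\|x\|_2=\tau(x^*x)^{1/2}$. Then for every $t\in\mathbb R$ there is a unique normal $*$-endomorphism $\alpha_t$ of $\tilde M$ with $$\alpha_t|_{D\bar\otimes A}=\operatorname{id}\quad\text{and}\quad \alpha_t(u_g)=(\omega(tb(g))\otimes1)u_g\ \text{ for all } g\in\Gamma .$$ Each $\alpha_t$ is a $*$-automorphism of $\tilde M$, and $(\alpha_t)_{t\in\mathbb R}$ is a one-parameter group: $\alpha_0=\operatorname{id}$ and $\alpha_{s+t}=\alpha_s\alpha_t$ for all $s,t\in\mathbb R$. Moreover $\lim_{t\to0}\|\alpha_t(x)-x\|_2=0$ for every $x\in\tilde M$. -/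

import Mathlib

open MeasureTheory ProbabilityTheory Filter Topology
open scoped ENNReal TensorProduct InnerProductSpace

noncomputable section

namespace CocycleDeformation

/-! ### Von Neumann algebras -/

section Hilbert

variable {K : Type*} [NormedAddCommGroup K] [InnerProductSpace ℂ K] [CompleteSpace K]

/-- The von Neumann algebra `(S ∪ S*)''` generated by a set `S` of bounded operators. -/
def vonNeumannClosure (S : Set (K →L[ℂ] K)) : VonNeumannAlgebra K where
  toStarSubalgebra := StarSubalgebra.centralizer ℂ (StarSubalgebra.centralizer ℂ S : Set (K →L[ℂ] K))
  centralizer_centralizer' := by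
    change Set.centralizer (Set.centralizer (StarSubalgebra.centralizer ℂ
      (StarSubalgebra.centralizer ℂ S : Set (K →L[ℂ] K)) : Set (K →L[ℂ] K))) =
      (StarSubalgebra.centralizer ℂ
      (StarSubalgebra.centralizer ℂ S : Set (K →L[ℂ] K)) : Set (K →L[ℂ] K))
    rw [StarSubalgebra.coe_centralizer_centralizer, Set.centralizer_centralizer_centralizer]

theorem subset_vonNeumannClosure (S : Set (K →L[ℂ] K)) :
    S ⊆ (vonNeumannClosure S).toStarSubalgebra :=
  fun _ hx => StarAlgebra.adjoin_le_centralizer_centralizer ℂ S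
    (StarAlgebra.subset_adjoin ℂ S hx)

end Hilbert

section Normal

variable {K : Type*} [NormedAddCommGroup K] [InnerProductSpace ℂ K] [CompleteSpace K]

/-- The ultraweakly continuous (normal) functionals `x ↦ ∑ₙ ⟪ξₙ, x ηₙ⟫`, with
`∑ₙ ‖ξₙ‖² < ∞` and `∑ₙ ‖ηₙ‖² < ∞`, on a von Neumann algebra. -/
def IsNormalFunctional (M : VonNeumannAlgebra K) (φ : M.toStarSubalgebra → ℂ) : Prop :=
  ∃ ξ η : lp (fun _ : ℕ => K) 2, ∀ x : M.toStarSubalgebra,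
    φ x = ∑' n, ⟪ξ n, (x : K →L[ℂ] K) (η n)⟫_ℂ

/-- A linear map from a von Neumann algebra to itself is normal (ultraweakly continuous) if composition
with it preserves normal functionals. -/
def IsNormalMap (M : VonNeumannAlgebra K) (β : M.toStarSubalgebra → M.toStarSubalgebra) : Prop :=
  ∀ φ : M.toStarSubalgebra → ℂ, IsNormalFunctional M φ → IsNormalFunctional M (fun x => φ (β x))

end Normal

/-! ### Tensor products -/

section Tensor

variable (E F : Type*) [NormedAddCommGroup E] [InnerProductSpace ℂ E]
  [NormedAddCommGroup F] [InnerProductSpace ℂ F]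

/-- The Hilbert space tensor product. -/
abbrev HilbertTensor : Type _ := UniformSpace.Completion (E ⊗[ℂ] F)

variable {E F}

theorem exists_orthonormal_sum (v : E ⊗[ℂ] F) : ∃ (n : ℕ) (u : Fin n → E) (f : Fin n → F),
    Orthonormal ℂ f ∧ v = ∑ j, u j ⊗ₜ[ℂ] f j := by
  obtain ⟨E', F', iE', iF', hz⟩ :=
    TensorProduct.exists_finite_submodule_of_setFinite {v} (Set.finite_singleton v)
  obtain ⟨y, hy⟩ := Set.singleton_subset_iff.mp hz
  let f := stdOrthonormalBasis ℂ F'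
  have key : ∀ y : E' ⊗[ℂ] F', ∃ u : Fin (Module.finrank ℂ F') → E,
      TensorProduct.mapIncl E' F' y = ∑ j, u j ⊗ₜ[ℂ] (f j : F) := by
    intro y
    induction y using TensorProduct.induction_on with
    | zero => exact ⟨0, by simp⟩
    | tmul a b =>
      refine ⟨fun j => ⟪f j, b⟫_ℂ • (a : E), ?_⟩
      simp only [TensorProduct.mapIncl, TensorProduct.map_tmul, Submodule.subtype_apply,
        TensorProduct.smul_tmul, ← TensorProduct.tmul_sum]
      congr 1
      conv_lhs => rw [← f.sum_repr' b]
      simp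
    | add a b ha hb =>
      obtain ⟨u, hu⟩ := ha
      obtain ⟨w, hw⟩ := hb
      exact ⟨u + w, by simp [map_add, hu, hw, TensorProduct.add_tmul, Finset.sum_add_distrib]⟩
  obtain ⟨u, hu⟩ := key y
  exact ⟨_, u, fun j => (f j : F), f.orthonormal.comp_linearIsometry F'.subtypeₗᵢ, hy ▸ hu⟩

theorem norm_sq_sum_tmul {n : ℕ} (u : Fin n → E) {f : Fin n → F} (hf : Orthonormal ℂ f) :
    ‖∑ j, u j ⊗ₜ[ℂ] f j‖ ^ 2 = ∑ j, ‖u j‖ ^ 2 := by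
  have : (‖∑ j, u j ⊗ₜ[ℂ] f j‖ ^ 2 : ℂ) = ∑ j, (‖u j‖ ^ 2 : ℂ) := by
    have h := inner_self_eq_norm_sq_to_K (𝕜 := ℂ) (∑ j, u j ⊗ₜ[ℂ] f j)
    simp only [Complex.coe_algebraMap] at h
    rw [← h]
    simp only [sum_inner, inner_sum, TensorProduct.inner_tmul]
    simp_rw [orthonormal_iff_ite.mp hf]
    simp [inner_self_eq_norm_sq_to_K]
  exact_mod_cast this

theorem norm_map_id_le (S : E →L[ℂ] E) (v : E ⊗[ℂ] F) :
    ‖TensorProduct.map (S : E →ₗ[ℂ] E) (LinearMap.id : F →ₗ[ℂ] F) v‖ ≤ ‖S‖ * ‖v‖ := by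
  obtain ⟨n, u, f, hf, rfl⟩ := exists_orthonormal_sum v
  refine le_of_sq_le_sq ?_ (by positivity)
  rw [mul_pow, norm_sq_sum_tmul u hf, map_sum]
  simp only [TensorProduct.map_tmul, LinearMap.id_apply]
  rw [norm_sq_sum_tmul _ hf, Finset.mul_sum]
  refine Finset.sum_le_sum fun j _ => ?_
  rw [← mul_pow]
  exact pow_le_pow_left₀ (norm_nonneg _) (S.le_opNorm _) 2

theorem norm_map_le (S : E →L[ℂ] E) (T : F →L[ℂ] F) (v : E ⊗[ℂ] F) :
    ‖TensorProduct.map (S : E →ₗ[ℂ] E) (T : F →ₗ[ℂ] F) v‖ ≤ ‖S‖ * ‖T‖ * ‖v‖ := by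
  have h1 : TensorProduct.map (S : E →ₗ[ℂ] E) (T : F →ₗ[ℂ] F) v =
      TensorProduct.map (S : E →ₗ[ℂ] E) LinearMap.id
        (TensorProduct.comm ℂ F E (TensorProduct.map (T : F →ₗ[ℂ] F) LinearMap.id
          (TensorProduct.comm ℂ E F v))) := by
    induction v using TensorProduct.induction_on with
    | zero => simp
    | tmul a b => simp
    | add a b ha hb => simp only [map_add, ha, hb]
  rw [h1, mul_assoc]
  refine (norm_map_id_le S _).trans (mul_le_mul_of_nonneg_left ?_ (norm_nonneg _))
  rw [TensorProduct.norm_comm]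
  refine (norm_map_id_le T _).trans ?_
  rw [TensorProduct.norm_comm]

/-- The bounded operator `S ⊗ T` on the Hilbert space tensor product. -/
def opTensor (S : E →L[ℂ] E) (T : F →L[ℂ] F) : HilbertTensor E F →L[ℂ] HilbertTensor E F :=
  ((TensorProduct.map (S : E →ₗ[ℂ] E) (T : F →ₗ[ℂ] F)).mkContinuous (‖S‖ * ‖T‖)
    (norm_map_le S T)).completion

theorem opTensor_tmul (S : E →L[ℂ] E) (T : F →L[ℂ] F) (x : E) (y : F) :
    opTensor S T ((x ⊗ₜ[ℂ] y : E ⊗[ℂ] F) : HilbertTensor E F) =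
      ((S x ⊗ₜ[ℂ] T y : E ⊗[ℂ] F) : HilbertTensor E F) := by
  rw [opTensor, ContinuousLinearMap.completion_apply_coe]
  rfl

theorem hilbertTensor_ext {G : Type*} [NormedAddCommGroup G] [NormedSpace ℂ G]
    {A B : HilbertTensor E F →L[ℂ] G}
    (h : ∀ (x : E) (y : F), A ((x ⊗ₜ[ℂ] y : E ⊗[ℂ] F) : HilbertTensor E F) =
      B ((x ⊗ₜ[ℂ] y : E ⊗[ℂ] F) : HilbertTensor E F)) : A = B := by
  ext v
  induction v using UniformSpace.Completion.induction_on with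
  | hp => exact isClosed_eq A.continuous B.continuous
  | ih v =>
    induction v using TensorProduct.induction_on with
    | zero => rw [UniformSpace.Completion.coe_zero, map_zero, map_zero]
    | tmul a b => exact h a b
    | add a b ha hb => rw [UniformSpace.Completion.coe_add, map_add, map_add, ha, hb]

theorem opTensor_mul (S S' : E →L[ℂ] E) (T T' : F →L[ℂ] F) :
    opTensor (S * S') (T * T') = opTensor S T * opTensor S' T' :=
  hilbertTensor_ext fun x y => by simp [opTensor_tmul]

theorem opTensor_one : opTensor (1 : E →L[ℂ] E) (1 : F →L[ℂ] F) = 1 :=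
  hilbertTensor_ext fun x y => by simp [opTensor_tmul]

variable [CompleteSpace E] [CompleteSpace F]

theorem opTensor_star (S : E →L[ℂ] E) (T : F →L[ℂ] F) :
    star (opTensor S T) = opTensor (star S) (star T) := by
  rw [ContinuousLinearMap.star_eq_adjoint]
  symm
  rw [ContinuousLinearMap.eq_adjoint_iff]
  intro v w
  induction v, w using UniformSpace.Completion.induction_on₂ with
  | hp => exact isClosed_eq (by fun_prop) (by fun_prop)
  | ih v w =>
    induction v using TensorProduct.induction_on with
    | zero => rw [UniformSpace.Completion.coe_zero, map_zero, inner_zero_left, inner_zero_left]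
    | add a b ha hb =>
      rw [UniformSpace.Completion.coe_add, map_add, inner_add_left, inner_add_left, ha, hb]
    | tmul a b =>
      induction w using TensorProduct.induction_on with
      | zero => rw [UniformSpace.Completion.coe_zero, map_zero, inner_zero_right, inner_zero_right]
      | add a b ha hb =>
        rw [UniformSpace.Completion.coe_add, map_add, inner_add_right, inner_add_right, ha, hb]
      | tmul c d =>
        simp [opTensor_tmul, UniformSpace.Completion.inner_coe, TensorProduct.inner_tmul,
          ContinuousLinearMap.star_eq_adjoint, ContinuousLinearMap.adjoint_inner_left]

/-- The tensor product `U ⊗ V` of two unitary representations. -/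
def tensorRep {Γ : Type*} [Group Γ] (U : Γ →* unitary (E →L[ℂ] E)) (V : Γ →* unitary (F →L[ℂ] F)) :
    Γ →* unitary (HilbertTensor E F →L[ℂ] HilbertTensor E F) where
  toFun g := ⟨opTensor (U g) (V g), by
    rw [Unitary.mem_iff, opTensor_star, ← opTensor_mul, ← opTensor_mul]
    simp [opTensor_one]⟩
  map_one' := Subtype.ext (by simp [opTensor_one])
  map_mul' g h := Subtype.ext (by simp [opTensor_mul])

/-- The von Neumann algebra tensor product `M ⊗̄ N`, generated by the operators `x ⊗ y` with `x ∈ M`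
and `y ∈ N`. -/
def vonNeumannTensor (M : VonNeumannAlgebra E) (N : VonNeumannAlgebra F) :
    VonNeumannAlgebra (HilbertTensor E F) :=
  vonNeumannClosure {z | ∃ x ∈ M, ∃ y ∈ N, z = opTensor x y}

theorem opTensor_mem {M : VonNeumannAlgebra E} {N : VonNeumannAlgebra F} {x : E →L[ℂ] E}
    {y : F →L[ℂ] F} (hx : x ∈ M) (hy : y ∈ N) :
    opTensor x y ∈ (vonNeumannTensor M N).toStarSubalgebra :=
  subset_vonNeumannClosure _ ⟨x, hx, y, hy, rfl⟩

end Tensor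

/-! ### Crossed products -/

section Crossed

variable {Γ : Type*} {K : Type*} [NormedAddCommGroup K] [InnerProductSpace ℂ K]

theorem memℓp_diag (T : Γ → (K →L[ℂ] K)) (C : ℝ) (hT : ∀ h, ‖T h‖ ≤ C)
    (ξ : lp (fun _ : Γ => K) 2) : Memℓp (fun h => T h (ξ h)) 2 :=
  ((lp.memℓp ξ).norm.const_mul C).mono fun h =>
    (T h).le_of_opNorm_le (hT h) _

/-- The diagonal operator `(ξ_h)_h ↦ (T_h ξ_h)_h` on `ℓ²(Γ, K)` given by a bounded family `T`. -/
def diagOp (T : Γ → (K →L[ℂ] K)) (C : ℝ) (hT : ∀ h, ‖T h‖ ≤ C) :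
    lp (fun _ : Γ => K) 2 →L[ℂ] lp (fun _ : Γ => K) 2 :=
  LinearMap.mkContinuous
    { toFun := fun ξ => ⟨fun h => T h (ξ h), memℓp_diag T C hT ξ⟩
      map_add' := fun ξ η => lp.ext (funext fun h => map_add (T h) (ξ h) (η h))
      map_smul' := fun c ξ => lp.ext (funext fun h => map_smul (T h) c (ξ h)) }
    |C| fun ξ => by
      have : |C| * ‖ξ‖ = ‖(C : ℂ) • ξ‖ := by
        rw [norm_smul, Complex.norm_real, Real.norm_eq_abs]
      rw [this]
      refine lp.norm_mono (by norm_num) fun h => ?_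
      refine ((T h).le_of_opNorm_le (hT h) _).trans ?_
      rw [lp.coeFn_smul, Pi.smul_apply, norm_smul]
      exact mul_le_mul_of_nonneg_right (by simpa using le_abs_self C) (norm_nonneg _)

theorem diagOp_apply (T : Γ → (K →L[ℂ] K)) (C : ℝ) (hT : ∀ h, ‖T h‖ ≤ C)
    (ξ : lp (fun _ : Γ => K) 2) (h : Γ) : diagOp T C hT ξ h = T h (ξ h) := rfl

variable [Group Γ]

/-- The left translation `(λ_g ξ)(h) = ξ(g⁻¹ h)` on `ℓ²(Γ, K)`. -/
def leftShift (g : Γ) : lp (fun _ : Γ => K) 2 →L[ℂ] lp (fun _ : Γ => K) 2 :=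
  LinearMap.mkContinuous
    { toFun := fun ξ => ⟨fun h => ξ (g⁻¹ * h), by
        refine memℓp_gen ?_
        exact ((lp.memℓp ξ).summable (by norm_num)).comp_injective (mul_right_injective g⁻¹)⟩
      map_add' := fun ξ η => rfl
      map_smul' := fun c ξ => rfl }
    1 fun ξ => by
      rw [one_mul]
      refine lp.norm_le_of_tsum_le (by norm_num) (norm_nonneg _) (le_of_eq ?_)
      rw [lp.norm_rpow_eq_tsum (by norm_num)]
      exact (Equiv.mulLeft g⁻¹).tsum_eq (fun h => ‖ξ h‖ ^ (2 : ℝ≥0∞).toReal)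

theorem leftShift_apply (g : Γ) (ξ : lp (fun _ : Γ => K) 2) (h : Γ) :
    leftShift g ξ h = ξ (g⁻¹ * h) := rfl

variable [CompleteSpace K] (U : Γ →* unitary (K →L[ℂ] K))

/-- The automorphism `σ_g = Ad U_g`, `σ_g(x) = U_g x U_g*`, of the bounded operators. -/
def conj (g : Γ) (x : K →L[ℂ] K) : K →L[ℂ] K :=
  (U g : K →L[ℂ] K) * x * star (U g : K →L[ℂ] K)

theorem norm_conj_le (g : Γ) (x : K →L[ℂ] K) : ‖conj U g x‖ ≤ ‖x‖ := by
  rw [conj, CStarRing.norm_mul_mem_unitary _ (Unitary.star_mem (U g).2), 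
    CStarRing.norm_mem_unitary_mul _ (U g).2]

/-- The representation `(π_σ(x) ξ)(h) = σ_{h⁻¹}(x) ξ(h)` of operators `x` on `K` by operators on
`ℓ²(Γ, K)`. -/
def crossedRep (x : K →L[ℂ] K) : lp (fun _ : Γ => K) 2 →L[ℂ] lp (fun _ : Γ => K) 2 :=
  diagOp (fun h => conj U h⁻¹ x) ‖x‖ fun h => norm_conj_le U h⁻¹ x

/-- The crossed product `N ⋊ Γ` of a von Neumann algebra `N` on `K` by the action `σ_g = Ad U_g` of
`Γ`, where the unitaries `U_g` normalize `N`. It is the von Neumann algebra on `ℓ²(Γ, K)` generated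
by the operators `π_σ(x)` with `x ∈ N` and the translations `λ_g` with `g ∈ Γ`. -/
def crossedProduct (N : VonNeumannAlgebra K) : VonNeumannAlgebra (lp (fun _ : Γ => K) 2) :=
  vonNeumannClosure ({z | ∃ x ∈ N, z = crossedRep U x} ∪ Set.range leftShift)

/-- The copy in `N ⋊ Γ` of an element of `N`. -/
def crossedIncl (N : VonNeumannAlgebra K) (x : N.toStarSubalgebra) :
    (crossedProduct U N).toStarSubalgebra :=
  ⟨crossedRep U x, subset_vonNeumannClosure _ (Or.inl ⟨x, x.2, rfl⟩)⟩

/-- The canonical unitaries `u_g` of `N ⋊ Γ`. -/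
def crossedUnitary (N : VonNeumannAlgebra K) (g : Γ) : (crossedProduct U N).toStarSubalgebra :=
  ⟨leftShift g, subset_vonNeumannClosure _ (Or.inr ⟨g, rfl⟩)⟩

/-- The canonical unitaries implement the action: `u_g x u_g* = σ_g(x)`, or `u_g x = σ_g(x) u_g`. -/
theorem leftShift_mul_crossedRep (g : Γ) (x : K →L[ℂ] K) :
    (leftShift g : lp (fun _ : Γ => K) 2 →L[ℂ] _) * crossedRep U x =
      crossedRep U (conj U g x) * leftShift g := by
  ext ξ h
  change conj U (g⁻¹ * h)⁻¹ x (ξ (g⁻¹ * h)) = conj U h⁻¹ (conj U g x) (ξ (g⁻¹ * h))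
  simp [conj, mul_assoc]

end Crossed

/-! ### Multiplication and Koopman operators -/

section Multiplication

variable {Z : Type*} [MeasurableSpace Z] (ν : Measure Z)

/-- The operator of multiplication by `f ∈ L^∞(Z, ν)` on `L²(Z, ν)`. -/
def mulOp (f : Lp ℂ ∞ ν) : Lp ℂ 2 ν →L[ℂ] Lp ℂ 2 ν :=
  (ContinuousLinearMap.mul ℂ ℂ).holderL ν ∞ 2 2 f

theorem mulOp_apply (f : Lp ℂ ∞ ν) (ψ : Lp ℂ 2 ν) :
    mulOp ν f ψ =ᵐ[ν] fun z => f z * ψ z :=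
  (ContinuousLinearMap.mul ℂ ℂ).coeFn_holder (r := 2) f ψ

/-- The unitary representation `(U_g ψ)(z) = ψ(T_g z)` on `L²(Z, ν)` given by measure preserving
maps `T_g` with `T_{gh} = T_h ∘ T_g` almost everywhere. -/
def koopmanRep {Γ : Type*} [Group Γ] (T : Γ → Z → Z) (hT : ∀ g, MeasurePreserving (T g) ν ν)
    (h_one : T 1 =ᵐ[ν] id) (h_mul : ∀ g h, T (g * h) =ᵐ[ν] T h ∘ T g) :
    Γ →* unitary (Lp ℂ 2 ν →L[ℂ] Lp ℂ 2 ν) :=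
  let V : Γ → (Lp ℂ 2 ν →ₗᵢ[ℂ] Lp ℂ 2 ν) :=
    fun g => Lp.compMeasurePreservingₗᵢ ℂ (T g) (hT g)
  have hV : ∀ g (ψ : Lp ℂ 2 ν), V g ψ =ᵐ[ν] fun z => ψ (T g z) :=
    fun g ψ => Lp.coeFn_compMeasurePreserving ψ (hT g)
  have hV1 : ∀ ψ : Lp ℂ 2 ν, V 1 ψ = ψ := fun ψ => Lp.ext (by
    filter_upwards [hV 1 ψ, h_one] with z h1 h2
    rw [h1, h2, id])
  have hVmul : ∀ g h (ψ : Lp ℂ 2 ν), V (g * h) ψ = V g (V h ψ) := fun g h ψ => Lp.ext (by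
    filter_upwards [hV (g * h) ψ, hV g (V h ψ), (hT g).quasiMeasurePreserving.ae (hV h ψ),
      h_mul g h] with z h1 h2 h3 h4
    rw [h1, h2, h3, h4, Function.comp_apply])
  have hVstar : ∀ g, star (V g).toContinuousLinearMap = (V g⁻¹).toContinuousLinearMap := by
    intro g
    rw [ContinuousLinearMap.star_eq_adjoint]
    symm
    rw [ContinuousLinearMap.eq_adjoint_iff]
    intro x y
    change ⟪V g⁻¹ x, y⟫_ℂ = ⟪x, V g y⟫_ℂ
    rw [← (V g).inner_map_map, ← hVmul, mul_inv_cancel, hV1]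
  { toFun := fun g => ⟨(V g).toContinuousLinearMap, by
      rw [Unitary.mem_iff, hVstar]
      constructor
      · ext1 ψ
        change V g⁻¹ (V g ψ) = ψ
        rw [← hVmul, inv_mul_cancel, hV1]
      · ext1 ψ
        change V g (V g⁻¹ ψ) = ψ
        rw [← hVmul, mul_inv_cancel, hV1]⟩
    map_one' := Subtype.ext (ContinuousLinearMap.ext hV1)
    map_mul' := fun g h => Subtype.ext (ContinuousLinearMap.ext (hVmul g h)) }

theorem koopmanRep_apply {Γ : Type*} [Group Γ] (T : Γ → Z → Z)
    (hT : ∀ g, MeasurePreserving (T g) ν ν) (h_one : T 1 =ᵐ[ν] id)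
    (h_mul : ∀ g h, T (g * h) =ᵐ[ν] T h ∘ T g) (g : Γ) (ψ : Lp ℂ 2 ν) :
    (koopmanRep ν T hT h_one h_mul g : Lp ℂ 2 ν →L[ℂ] Lp ℂ 2 ν) ψ =ᵐ[ν] fun z => ψ (T g z) :=
  Lp.coeFn_compMeasurePreserving ψ (hT g)

/-- `L^∞(Z, ν)` as a von Neumann algebra acting on `L²(Z, ν)` by multiplication. The bicommutant adds
nothing for a probability measure, where the multiplication operators are maximal abelian. -/
def linftyAlgebra : VonNeumannAlgebra (Lp ℂ 2 ν) :=
  vonNeumannClosure (Set.range (mulOp ν))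

end Multiplication

/-! ### The Gaussian construction -/

section Gaussian

/-- The product measure `∏ (ℝ, (2π)^{-1/2} e^{-x²/2} dx)`. -/
def gaussianProduct (ι : Type*) : Measure (ι → ℝ) := Measure.infinitePi fun _ : ι => gaussianReal 0 1

instance (ι : Type*) : IsProbabilityMeasure (gaussianProduct ι) := by
  unfold gaussianProduct; infer_instance

variable {ι : Type*}

theorem memLp_coord (n : ι) : MemLp (fun z : ι → ℝ => z n) 2 (gaussianProduct ι) :=
  (memLp_id_gaussianReal' 2 (by simp)).comp_measurePreserving
    (measurePreserving_eval_infinitePi (fun _ : ι => gaussianReal 0 1) n)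

theorem map_coord (n : ι) : (gaussianProduct ι).map (fun z => z n) = gaussianReal 0 1 :=
  (measurePreserving_eval_infinitePi (fun _ : ι => gaussianReal 0 1) n).map_eq

/-- The `n`-th coordinate function in `L²(Z, ν; ℝ)`. -/
def coordLp (n : ι) : Lp ℝ 2 (gaussianProduct ι) := (memLp_coord n).toLp _

theorem orthonormal_coordLp : Orthonormal ℝ (coordLp : ι → Lp ℝ 2 (gaussianProduct ι)) := by
  classical
  have h0 : ∀ i : ι, ∫ z, z i ∂gaussianProduct ι = 0 := fun i => by
    have := integral_map (μ := gaussianProduct ι) (φ := fun z => z i) (f := fun x : ℝ => x)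
      (measurable_pi_apply i).aemeasurable (by fun_prop)
    rw [← this, map_coord]
    simp
  rw [orthonormal_iff_ite]
  intro i j
  have h1 : ⟪coordLp i, coordLp j⟫_ℝ = ∫ z, z i * z j ∂gaussianProduct ι := by
    rw [L2.inner_def]
    refine integral_congr_ae ?_
    filter_upwards [(memLp_coord i).coeFn_toLp, (memLp_coord j).coeFn_toLp] with z hi hj
    change ⟪((memLp_coord i).toLp _ : (ι → ℝ) → ℝ) z, ((memLp_coord j).toLp _ : (ι → ℝ) → ℝ) z⟫_ℝ = _
    rw [hi, hj]
    simp [mul_comm]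
  rw [h1]
  split_ifs with hij
  · subst hij
    have := integral_map (μ := gaussianProduct ι) (φ := fun z => z i) (f := fun x : ℝ => x * x)
      (measurable_pi_apply i).aemeasurable (by fun_prop)
    rw [← this, map_coord]
    have hv := variance_fun_id_gaussianReal (μ := 0) (v := 1)
    rw [variance_of_integral_eq_zero (by fun_prop) (by simp)] at hv
    simpa [sq] using hv
  · have hind := (iIndepFun_infinitePi (P := fun _ : ι => gaussianReal 0 1)
      (X := fun _ x => x) (fun _ => measurable_id)).indepFun hij
    have := hind.integral_fun_mul_eq_mul_integral (measurable_pi_apply i).aestronglyMeasurable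
      (measurable_pi_apply j).aestronglyMeasurable
    change ∫ z, z i * z j ∂(Measure.infinitePi fun _ : ι => gaussianReal 0 1) = 0
    rw [this]
    have := h0 i
    unfold gaussianProduct at this
    rw [this, zero_mul]

variable {H : Type*} [NormedAddCommGroup H] [InnerProductSpace ℝ H] (e : HilbertBasis ι ℝ H)

/-- The isometric embedding `H → L²(Z, ν; ℝ)`, `∑ cₙ eₙ ↦ ∑ cₙ zₙ`. -/
def gaussianField : H →ₗᵢ[ℝ] Lp ℝ 2 (gaussianProduct ι) :=
  orthonormal_coordLp.orthogonalFamily.linearIsometry.comp e.repr.toLinearIsometry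

theorem gaussianField_basis (n : ι) : gaussianField e (e n) =ᵐ[gaussianProduct ι] fun z => z n := by
  classical
  have : gaussianField e (e n) = coordLp n := by
    change orthonormal_coordLp.orthogonalFamily.linearIsometry (e.repr (e n)) = _
    rw [e.repr_self, OrthogonalFamily.linearIsometry_apply_single]
    simp
  rw [this]
  exact (memLp_coord n).coeFn_toLp

theorem gaussianField_sum {κ : Type*} (s : Finset κ) (c : κ → ℝ) (ξ : κ → H) :
    gaussianField e (∑ k ∈ s, c k • ξ k) =ᵐ[gaussianProduct ι]
      fun z => ∑ k ∈ s, c k * gaussianField e (ξ k) z := by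
  classical
  rw [map_sum]
  induction s using Finset.induction_on with
  | empty =>
    simp only [Finset.sum_empty]
    exact Lp.coeFn_zero _ _ _
  | insert a s ha ih =>
    simp only [Finset.sum_insert ha]
    rw [map_smul]
    filter_upwards [Lp.coeFn_add (c a • gaussianField e (ξ a)) (∑ k ∈ s, gaussianField e (c k • ξ k)),
      Lp.coeFn_smul (c a) (gaussianField e (ξ a)), ih] with z h1 h2 h3
    rw [h1, Pi.add_apply, h2, h3, Pi.smul_apply, smul_eq_mul]

theorem integral_exp_sum (s : Finset ι) (c : ι → ℝ) :
    ∫ z, Complex.exp (((∑ i ∈ s, c i * z i : ℝ) : ℂ) * Complex.I) ∂gaussianProduct ι =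
      Complex.exp (-((∑ i ∈ s, c i ^ 2 : ℝ) : ℂ) / 2) := by
  have hmeas : ∀ i, Measurable fun z : ι → ℝ => c i * z i :=
    fun i => measurable_const.mul (measurable_pi_apply i)
  have hind : iIndepFun (fun i (z : ι → ℝ) => c i * z i) (gaussianProduct ι) :=
    iIndepFun_infinitePi (P := fun _ : ι => gaussianReal 0 1) (X := fun i x => c i * x)
      (fun i => by fun_prop)
  have h := congrFun ((hind.precomp
    (Subtype.val_injective (p := fun i => i ∈ s))).charFun_map_fun_finsetSum_eq_prod
      (s := s) (X := fun i (z : ι → ℝ) => c i * z i)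
      (fun i _ => (hmeas i).aemeasurable)) 1
  rw [charFun_apply_real, integral_map (Finset.measurable_fun_sum s fun i _ =>
    hmeas i).aemeasurable (by fun_prop)] at h
  simp only [Complex.ofReal_one, one_mul] at h
  rw [h, Finset.prod_apply]
  have : ∀ i, charFun ((gaussianProduct ι).map fun z => c i * z i) 1 =
      Complex.exp (-((c i ^ 2 : ℝ) : ℂ) / 2) := by
    intro i
    have hm : (gaussianProduct ι).map (fun z => c i * z i) = (gaussianReal 0 1).map (c i * ·) := by
      rw [← map_coord i]
      exact (Measure.map_map (f := fun z : ι → ℝ => z i) (g := fun x : ℝ => c i * x)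
        (measurable_const.mul measurable_id) (measurable_pi_apply i)).symm
    rw [hm, gaussianReal_map_const_mul, charFun_gaussianReal]
    simp [neg_div]
  simp_rw [this]
  rw [← Complex.exp_sum]
  congr 1
  push_cast
  rw [neg_div, Finset.sum_div, ← Finset.sum_neg_distrib]
  exact Finset.sum_congr rfl fun i _ => by ring

/-- `gaussianField e ξ` has characteristic function `e^{-‖ξ‖²/2}`. -/
theorem integral_exp_gaussianField (ξ : H) :
    ∫ z, Complex.exp ((gaussianField e ξ z : ℂ) * Complex.I) ∂gaussianProduct ι =
      Complex.exp (-(‖ξ‖ ^ 2 : ℝ) / 2) := by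
  classical
  let f : H → ℂ := fun ξ =>
    ∫ z, Complex.exp ((gaussianField e ξ z : ℂ) * Complex.I) ∂gaussianProduct ι
  have hint : ∀ ξ, Integrable
      (fun z => Complex.exp ((gaussianField e ξ z : ℂ) * Complex.I)) (gaussianProduct ι) := by
    intro ξ
    refine Integrable.of_bound (C := 1) ?_ (Eventually.of_forall fun z => ?_)
    · exact (Complex.continuous_exp.comp_aestronglyMeasurable
        ((Complex.continuous_ofReal.comp_aestronglyMeasurable
          (Lp.aestronglyMeasurable _)).mul_const _))
    · rw [Complex.norm_exp_ofReal_mul_I]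
  have hlip : ∀ ξ η, ‖f ξ - f η‖ ≤ ‖ξ - η‖ := by
    intro ξ η
    have hI : Integrable (gaussianField e ξ - gaussianField e η : Lp ℝ 2 (gaussianProduct ι))
        (gaussianProduct ι) :=
      (Lp.memLp _).integrable (by norm_num)
    rw [← integral_sub (hint ξ) (hint η)]
    calc _ ≤ ∫ z, ‖(gaussianField e ξ - gaussianField e η : Lp ℝ 2 (gaussianProduct ι)) z‖
            ∂gaussianProduct ι := by
          refine norm_integral_le_of_norm_le hI.norm ?_
          filter_upwards [Lp.coeFn_sub (gaussianField e ξ) (gaussianField e η)] with z hz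
          rw [hz, Pi.sub_apply]
          have h1 : Complex.exp ((gaussianField e ξ z : ℂ) * Complex.I) -
              Complex.exp ((gaussianField e η z : ℂ) * Complex.I) =
              Complex.exp ((gaussianField e η z : ℂ) * Complex.I) *
              (Complex.exp (Complex.I * ((gaussianField e ξ z - gaussianField e η z : ℝ) : ℂ)) - 1) := by
            rw [mul_sub, ← Complex.exp_add, mul_one]
            congr 2
            push_cast
            ring
          rw [h1, norm_mul, Complex.norm_exp_ofReal_mul_I, one_mul]
          exact Real.norm_exp_I_mul_ofReal_sub_one_le
      _ ≤ ‖(gaussianField e ξ - gaussianField e η : Lp ℝ 2 (gaussianProduct ι))‖ := by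
          rw [integral_norm_eq_lintegral_enorm hI.1, ← eLpNorm_one_eq_lintegral_enorm, Lp.norm_def]
          exact ENNReal.toReal_mono (Lp.eLpNorm_ne_top _)
            (eLpNorm_le_eLpNorm_of_exponent_le (by norm_num) hI.1)
      _ = ‖ξ - η‖ := by rw [← map_sub, LinearIsometry.norm_map]
  have hcont : Continuous f :=
    (LipschitzWith.of_dist_le_mul (K := 1) fun ξ η => by
      simpa [dist_eq_norm] using hlip ξ η).continuous
  have hlim : Tendsto (fun s : Finset ι => ∑ i ∈ s, e.repr ξ i • e i) atTop (𝓝 ξ) :=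
    e.hasSum_repr ξ
  refine tendsto_nhds_unique ((hcont.tendsto ξ).comp hlim) ?_
  have h2 : Tendsto (fun s : Finset ι =>
      Complex.exp (-(‖∑ i ∈ s, e.repr ξ i • e i‖ ^ 2 : ℝ) / 2)) atTop
      (𝓝 (Complex.exp (-(‖ξ‖ ^ 2 : ℝ) / 2))) :=
    ((by fun_prop : Continuous fun ζ : H => Complex.exp (-((‖ζ‖ ^ 2 : ℝ) : ℂ) / 2)).tendsto ξ).comp hlim
  refine h2.congr fun s => ?_
  have h3 : ‖∑ i ∈ s, e.repr ξ i • e i‖ ^ 2 = ∑ i ∈ s, e.repr ξ i ^ 2 := by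
    rw [← real_inner_self_eq_norm_sq, e.orthonormal.inner_sum]
    exact Finset.sum_congr rfl fun i _ => by simp [sq]
  rw [h3, ← integral_exp_sum]
  refine integral_congr_ae ?_
  have h4 : ∀ᵐ z ∂gaussianProduct ι, ∀ i ∈ s, gaussianField e (e i) z = z i :=
    (Finset.eventually_all s).2 fun i _ => gaussianField_basis e i
  filter_upwards [gaussianField_sum e s (e.repr ξ) e, h4] with z hz hz'
  rw [hz]
  congr 3
  exact (Finset.sum_congr rfl fun i hi => by rw [hz' i hi]).symm

/-- The transformation of `Z` with coordinates `(T z)_n = (gaussianField e (R e_n))(z)`. -/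
def gaussianMap (R : H ≃ₗᵢ[ℝ] H) (z : ι → ℝ) : ι → ℝ := fun n => gaussianField e (R (e n)) z

theorem measurable_gaussianMap (R : H ≃ₗᵢ[ℝ] H) : Measurable (gaussianMap e R) :=
  measurable_pi_lambda _ fun _ => (Lp.stronglyMeasurable _).measurable

theorem measurePreserving_gaussianMap (R : H ≃ₗᵢ[ℝ] H) :
    MeasurePreserving (gaussianMap e R) (gaussianProduct ι) (gaussianProduct ι) := by
  refine ⟨measurable_gaussianMap e R, ?_⟩
  have hlim : IsProjectiveLimit (gaussianProduct ι)
      (fun I : Finset ι => Measure.pi fun _ : I => gaussianReal 0 1) :=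
    Measure.isProjectiveLimit_infinitePi fun _ : ι => gaussianReal 0 1
  refine IsProjectiveLimit.unique ?_ hlim
  intro s
  rw [Measure.map_map (Finset.measurable_restrict s) (measurable_gaussianMap e R)]
  have hm : Measurable (s.restrict ∘ gaussianMap e R) :=
    (Finset.measurable_restrict s).comp (measurable_gaussianMap e R)
  have := Measure.isProbabilityMeasure_map (μ := gaussianProduct ι) hm.aemeasurable
  rw [← charFun_eq_pi_iff]
  intro t
  rw [charFun_apply, integral_map (by fun_prop) (by fun_prop),
    integral_map hm.aemeasurable (by fun_prop)]
  simp_rw [charFun_gaussianReal]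
  rw [← Complex.exp_sum]
  have h1 := integral_exp_gaussianField e (∑ i : s, t i • R (e i))
  have h2 : ‖∑ i : s, t i • R (e i)‖ ^ 2 = ∑ i : s, t i ^ 2 := by
    have ho : Orthonormal ℝ (fun i : s => R (e i)) :=
      (e.orthonormal.comp_linearIsometryEquiv R).comp _ Subtype.val_injective
    rw [← real_inner_self_eq_norm_sq, ho.inner_sum]
    exact Finset.sum_congr rfl fun i _ => by simp [sq]
  rw [h2] at h1
  convert h1 using 1
  · refine integral_congr_ae ?_
    filter_upwards [gaussianField_sum e Finset.univ t (fun i : s => R (e i))] with z hz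
    rw [hz, PiLp.inner_apply]
    congr 3
  · congr 1
    push_cast
    rw [neg_div, Finset.sum_div, ← Finset.sum_neg_distrib]
    exact Finset.sum_congr rfl fun i _ => by simp

/-- `gaussianField e ξ` composed with the transformation given by `R` is `gaussianField e (R ξ)`. -/
theorem gaussianField_gaussianMap (R : H ≃ₗᵢ[ℝ] H) (ξ : H) :
    (fun z => gaussianField e ξ (gaussianMap e R z)) =ᵐ[gaussianProduct ι]
      gaussianField e (R ξ) := by
  classical
  let C : Lp ℝ 2 (gaussianProduct ι) →ₗᵢ[ℝ] Lp ℝ 2 (gaussianProduct ι) :=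
    Lp.compMeasurePreservingₗᵢ ℝ (gaussianMap e R) (measurePreserving_gaussianMap e R)
  have hC : ∀ ψ : Lp ℝ 2 (gaussianProduct ι),
      C ψ =ᵐ[gaussianProduct ι] fun z => ψ (gaussianMap e R z) :=
    fun ψ => Lp.coeFn_compMeasurePreserving ψ (measurePreserving_gaussianMap e R)
  have key : C (gaussianField e ξ) = gaussianField e (R ξ) := by
    have hlim := e.hasSum_repr ξ
    have h1 := hlim.mapL (C.comp (gaussianField e)).toContinuousLinearMap
    have h2 := hlim.mapL ((gaussianField e).comp R.toLinearIsometry).toContinuousLinearMap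
    refine h1.unique (h2.congr_fun ?_)
    intro i
    change C (gaussianField e (e.repr ξ i • e i)) = gaussianField e (R (e.repr ξ i • e i))
    simp only [map_smul]
    congr 1
    refine Lp.ext ?_
    filter_upwards [hC (gaussianField e (e i)),
      (measurePreserving_gaussianMap e R).quasiMeasurePreserving.ae (gaussianField_basis e i)]
      with z h3 h4
    rw [h3, h4]
    rfl
  rw [← key]
  exact (hC _).symm

theorem memLp_omega (ξ : H) :
    MemLp (fun z => Complex.exp (√2 * Complex.I * gaussianField e ξ z)) ∞ (gaussianProduct ι) := by
  refine memLp_top_of_bound ?_ 1 (Eventually.of_forall fun z => ?_)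
  · exact (Complex.continuous_exp.comp_aestronglyMeasurable
      ((Complex.continuous_ofReal.comp_aestronglyMeasurable
        (Lp.aestronglyMeasurable _)).const_mul _))
  · have : (√2 * Complex.I * gaussianField e ξ z : ℂ) =
        ((√2 * gaussianField e ξ z : ℝ) : ℂ) * Complex.I := by
      push_cast; ring
    rw [this, Complex.norm_exp_ofReal_mul_I]

/-- The unitary `ω(ξ) = exp(√2 i ∑ₙ cₙ zₙ) ∈ L^∞(Z, ν)`, for `ξ = ∑ₙ cₙ eₙ ∈ H`. For a finite sum
this is a pointwise formula; in general the sum in the exponent converges in `L²(Z, ν)`. -/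
def omega (ξ : H) : Lp ℂ ∞ (gaussianProduct ι) := (memLp_omega e ξ).toLp _

theorem omega_finset_sum (s : Finset ι) (c : ι → ℝ) :
    omega e (∑ n ∈ s, c n • e n) =ᵐ[gaussianProduct ι]
      fun z => Complex.exp (√2 * Complex.I * ∑ n ∈ s, (c n : ℂ) * z n) := by
  have h : ∀ᵐ z ∂gaussianProduct ι, ∀ i ∈ s, gaussianField e (e i) z = z i :=
    (Finset.eventually_all s).2 fun i _ => gaussianField_basis e i
  filter_upwards [(memLp_omega e (∑ n ∈ s, c n • e n)).coeFn_toLp, gaussianField_sum e s c e, h]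
    with z h1 h2 h3
  rw [omega, h1, h2, Finset.sum_congr rfl fun i hi => by rw [h3 i hi]]
  push_cast
  rfl

theorem omega_add (ξ η : H) :
    omega e (ξ + η) =ᵐ[gaussianProduct ι] fun z => omega e ξ z * omega e η z := by
  filter_upwards [(memLp_omega e ξ).coeFn_toLp, (memLp_omega e η).coeFn_toLp,
    (memLp_omega e (ξ + η)).coeFn_toLp, Lp.coeFn_add (gaussianField e ξ) (gaussianField e η)]
    with z h1 h2 h3 h4
  rw [omega, h3, omega, h1, omega, h2, map_add, h4, ← Complex.exp_add, Pi.add_apply]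
  congr 1
  push_cast
  ring

/-- The trace of `ω(ξ)` is `e^{-‖ξ‖²}`. -/
theorem integral_omega (ξ : H) :
    ∫ z, omega e ξ z ∂gaussianProduct ι = Complex.exp (-(‖ξ‖ ^ 2 : ℝ)) := by
  have h := integral_exp_gaussianField e (√2 • ξ)
  rw [norm_smul, mul_pow, Real.norm_eq_abs, sq_abs, Real.sq_sqrt (by norm_num)] at h
  convert h using 1
  · refine integral_congr_ae ?_
    filter_upwards [(memLp_omega e ξ).coeFn_toLp, Lp.coeFn_smul √2 (gaussianField e ξ)] with z h1 h2
    rw [omega, h1, map_smul, h2, Pi.smul_apply, smul_eq_mul]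
    congr 1
    push_cast
    ring
  · congr 1
    push_cast
    ring

/-- The von Neumann algebra `D ⊆ L^∞(Z, ν)` generated by the unitaries `ω(ξ)`, `ξ ∈ H`. -/
def gaussianAlgebra : VonNeumannAlgebra (Lp ℂ 2 (gaussianProduct ι)) :=
  vonNeumannClosure (Set.range fun ξ : H => mulOp (gaussianProduct ι) (omega e ξ))

variable {Γ : Type*} [Group Γ] [Countable ι] (π : Γ →* (H ≃ₗᵢ[ℝ] H))

/-- The unitary representation of `Γ` on `L²(Z, ν)` that implements the Gaussian action. -/
def gaussianRep : Γ →* unitary (Lp ℂ 2 (gaussianProduct ι) →L[ℂ] Lp ℂ 2 (gaussianProduct ι)) :=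
  koopmanRep (gaussianProduct ι) (fun g => gaussianMap e (π g))
    (fun g => measurePreserving_gaussianMap e (π g))
    (by
      filter_upwards [ae_all_iff.2 fun n => gaussianField_basis e n] with z hz
      funext n
      simpa [gaussianMap] using hz n)
    (fun g h => by
      filter_upwards [ae_all_iff.2 fun n => gaussianField_gaussianMap e (π g) (π h (e n))]
        with z hz
      funext n
      simpa [gaussianMap] using (hz n).symm)

/-- The Gaussian action on `D` is determined by `γ · ω(ξ) = ω(π(γ) ξ)`. -/
theorem conj_gaussianRep_omega (g : Γ) (ξ : H) :
    conj (gaussianRep e π) g (mulOp (gaussianProduct ι) (omega e ξ)) =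
      mulOp (gaussianProduct ι) (omega e (π g ξ)) := by
  have hU := (gaussianRep e π g).2
  have key : (gaussianRep e π g : Lp ℂ 2 (gaussianProduct ι) →L[ℂ] Lp ℂ 2 (gaussianProduct ι)) *
      mulOp (gaussianProduct ι) (omega e ξ) =
      mulOp (gaussianProduct ι) (omega e (π g ξ)) * gaussianRep e π g := by
    ext1 ψ
    refine Lp.ext ?_
    have hT := (measurePreserving_gaussianMap e (π g)).quasiMeasurePreserving
    have hU : ∀ φ : Lp ℂ 2 (gaussianProduct ι),
        (gaussianRep e π g : Lp ℂ 2 (gaussianProduct ι) →L[ℂ] Lp ℂ 2 (gaussianProduct ι)) φ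
          =ᵐ[gaussianProduct ι] fun z => φ (gaussianMap e (π g) z) :=
      fun φ => koopmanRep_apply _ _ _ _ _ g φ
    filter_upwards [hU (mulOp (gaussianProduct ι) (omega e ξ) ψ), hU ψ,
      hT.ae (mulOp_apply (gaussianProduct ι) (omega e ξ) ψ),
      mulOp_apply (gaussianProduct ι) (omega e (π g ξ)) ((gaussianRep e π g :
        Lp ℂ 2 (gaussianProduct ι) →L[ℂ] Lp ℂ 2 (gaussianProduct ι)) ψ),
      hT.ae (memLp_omega e ξ).coeFn_toLp, (memLp_omega e (π g ξ)).coeFn_toLp,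
      gaussianField_gaussianMap e (π g) ξ] with z h1 h2 h3 h4 h5 h6 h7
    refine h1.trans (h3.trans (Eq.trans ?_ h4.symm))
    rw [h2, omega, h5, omega, h6, h7]
  rw [conj, key, mul_assoc, Unitary.mul_star_self_of_mem hU, mul_one]

end Gaussian

/-! ### The algebra `M̃ = (D ⊗̄ A) ⋊ Γ` and its deformation -/

section Deformation

variable {Γ : Type*} [Group Γ] {X : Type*} [MeasurableSpace X] (μ : Measure X)
  [MulAction Γ X] [MeasurableConstSMul Γ X] [SMulInvariantMeasure Γ X μ]

/-- The unitary representation `(V_g ψ)(x) = ψ(g⁻¹ x)` on `L²(X, μ)`. -/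
def actionRep : Γ →* unitary (Lp ℂ 2 μ →L[ℂ] Lp ℂ 2 μ) :=
  koopmanRep μ (fun g x => g⁻¹ • x) (fun g => measurePreserving_smul g⁻¹ μ)
    (Eventually.of_forall fun x => by simp)
    (fun g h => Eventually.of_forall fun x => by simp [mul_smul])

variable {ι : Type*} {H : Type*} [NormedAddCommGroup H] [InnerProductSpace ℝ H]
  (e : HilbertBasis ι ℝ H)

/-- The von Neumann algebra `D ⊗̄ A` on `L²(Z, ν) ⊗ L²(X, μ)`, where `A = L^∞(X, μ)`. -/
def baseAlgebra : VonNeumannAlgebra (HilbertTensor (Lp ℂ 2 (gaussianProduct ι)) (Lp ℂ 2 μ)) :=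
  vonNeumannTensor (gaussianAlgebra e) (linftyAlgebra μ)

/-- The element `ω(ξ) ⊗ 1` of `D ⊗̄ A`. -/
def omegaTensorOne (ξ : H) : (baseAlgebra μ e).toStarSubalgebra :=
  ⟨opTensor (mulOp (gaussianProduct ι) (omega e ξ)) 1,
    opTensor_mem (subset_vonNeumannClosure _ ⟨ξ, rfl⟩)
      (one_mem (linftyAlgebra μ).toStarSubalgebra)⟩

/-- The unit vector `1 ⊗ 1` of `L²(Z, ν) ⊗ L²(X, μ)`. -/
def baseVector [IsProbabilityMeasure μ] :
    HilbertTensor (Lp ℂ 2 (gaussianProduct ι)) (Lp ℂ 2 μ) :=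
  ((Lp.const 2 (gaussianProduct ι) (1 : ℂ) ⊗ₜ[ℂ] Lp.const 2 μ (1 : ℂ) :
    Lp ℂ 2 (gaussianProduct ι) ⊗[ℂ] Lp ℂ 2 μ) : HilbertTensor _ _)

variable [Countable ι] (π : Γ →* (H ≃ₗᵢ[ℝ] H))

/-- The unitary representation on `L²(Z, ν) ⊗ L²(X, μ)` implementing the diagonal action `σ` of `Γ` on
`D ⊗̄ A`. -/
def diagonalRep : Γ →* unitary (HilbertTensor (Lp ℂ 2 (gaussianProduct ι)) (Lp ℂ 2 μ) →L[ℂ]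
    HilbertTensor (Lp ℂ 2 (gaussianProduct ι)) (Lp ℂ 2 μ)) :=
  tensorRep (gaussianRep e π) (actionRep μ)

/-- The von Neumann algebra `M̃ = (D ⊗̄ A) ⋊ Γ`, as a von Neumann algebra of operators. -/
def tildeM : VonNeumannAlgebra
    (lp (fun _ : Γ => HilbertTensor (Lp ℂ 2 (gaussianProduct ι)) (Lp ℂ 2 μ)) 2) :=
  crossedProduct (diagonalRep μ e π) (baseAlgebra μ e)

/-- The algebra `M̃` as a type. -/
abbrev TildeM : Type _ := (tildeM μ e π).toStarSubalgebra

/-- The inclusion `D ⊗̄ A → M̃`. -/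
def baseIncl (x : (baseAlgebra μ e).toStarSubalgebra) : TildeM μ e π :=
  crossedIncl (diagonalRep μ e π) (baseAlgebra μ e) x

/-- The canonical unitaries `u_g ∈ M̃`. -/
def canonicalUnitary (g : Γ) : TildeM μ e π :=
  crossedUnitary (diagonalRep μ e π) (baseAlgebra μ e) g

/-- The requirements on `α_t` for a `*`-endomorphism `β` of `M̃`: it is normal, it is the identity on
`D ⊗̄ A`, and it maps `u_g` to `(ω(t b(g)) ⊗ 1) u_g`. -/
def IsDeformation (b : Γ → H) (t : ℝ) (β : TildeM μ e π → TildeM μ e π) : Prop :=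
  IsNormalMap (tildeM μ e π) β ∧
  (∀ x : (baseAlgebra μ e).toStarSubalgebra, β (baseIncl μ e π x) = baseIncl μ e π x) ∧
  ∀ g : Γ, β (canonicalUnitary μ e π g) =
    baseIncl μ e π (omegaTensorOne μ e (t • b g)) * canonicalUnitary μ e π g

variable [IsProbabilityMeasure μ]

open Classical in
/-- The canonical trace `τ(x) = ⟪Ω, x Ω⟫` of `M̃`, where `Ω = δ_1 ⊗ (1 ⊗ 1)`. It sends `∑_g x_g u_g` to
`∫ x_1 d(ν × μ)`. -/
def trace (x : TildeM μ e π) : ℂ :=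
  ⟪lp.single 2 (1 : Γ) (baseVector μ),
    (x : lp (fun _ : Γ => HilbertTensor (Lp ℂ 2 (gaussianProduct ι)) (Lp ℂ 2 μ)) 2 →L[ℂ]
      lp (fun _ : Γ => HilbertTensor (Lp ℂ 2 (gaussianProduct ι)) (Lp ℂ 2 μ)) 2)
      (lp.single 2 (1 : Γ) (baseVector μ))⟫_ℂ

/-- The 2-norm `‖x‖₂ = τ(x* x)^{1/2}`. -/
def twoNorm (x : TildeM μ e π) : ℝ := √(trace μ e π (star x * x)).re

end Deformation

end CocycleDeformation
end

/-! The deformation is spatial: it is conjugation by a unitary $W_t$ on $\ell^2(\Gamma,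
L^2(Z)\otimes L^2(X))$, diagonal over $\Gamma$, acting at the coordinate $h$ by
$\omega(-t\,b(h^{-1}))\otimes 1$. An element $x$ of $D\bar\otimes A$ acts at $h$ by
$\sigma_{h^{-1}}(x)$, and since $D$ is abelian this commutes with the phases, so $W_t$ fixes
$D\bar\otimes A$. At $h$, the operator $W_t\lambda_gW_t^*$ differs from $\lambda_g$ by the phase
$\omega(t\,b(h^{-1}g)-t\,b(h^{-1}))$. The cocycle identity turns this into
$\omega(t\,\pi(h^{-1})b(g))=\sigma_{h^{-1}}(\omega(t\,b(g)))$, the action at $h$ of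
$\omega(t\,b(g))$ (`deformationUnitary_mul_leftShift`). Thus conjugation by $W_t$ sends generators
into $\tilde M$, and a commutant argument (`conj_mem_of_generators`) extends this to all of $\tilde
M$; with $W_t^*=W_{-t}$ it is an automorphism.

Additivity of $\xi\mapsto\omega(\xi)$ in the exponent makes $t\mapsto W_t$ a one-parameter group.
Since $b(1)=0$, it fixes the trace vector $\Omega$, so $\|\alpha_t(x)-x\|_2=\|W_tx\Omega-x\Omega\|$,
and the continuity claim follows from strong continuity of $W_t$ at $0$
(`tendsto_deformationUnitary`), which comes from dominated convergence on $L^2(Z)$.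

For uniqueness, two normal $*$-endomorphisms agreeing on generators agree on a unital $*$-subalgebra
whose bicommutant contains $\tilde M$. Normal functionals are vector functionals of an
amplification, and von Neumann's density argument (`amplify_mem_closure`) shows that they are
determined on such a subalgebra. -/

noncomputable section

namespace CocycleDeformation

/-! ### Bicommutant density and uniqueness of normal homomorphisms -/

section Bicommutant

variable {K : Type*} [NormedAddCommGroup K] [InnerProductSpace ℂ K]

/-- The amplification `x ⊗ 1` of `x`, acting on `ℓ²(κ, K)`. -/
def amplify (κ : Type*) (x : K →L[ℂ] K) :
    lp (fun _ : κ => K) 2 →L[ℂ] lp (fun _ : κ => K) 2 :=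
  diagOp (fun _ => x) ‖x‖ fun _ => le_rfl

theorem amplify_apply {κ : Type*} (x : K →L[ℂ] K) (ξ : lp (fun _ : κ => K) 2) (k : κ) :
    amplify κ x ξ k = x (ξ k) := rfl

theorem lp_hom_ext {κ : Type*} [DecidableEq κ] {G : Type*} [NormedAddCommGroup G] [NormedSpace ℂ G]
    {S T : lp (fun _ : κ => K) 2 →L[ℂ] G}
    (h : ∀ k v, S (lp.single 2 k v) = T (lp.single 2 k v)) : S = T := by
  ext ξ
  have h1 := (lp.hasSum_single (by norm_num : (2 : ℝ≥0∞) ≠ ⊤) ξ)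
  have h2 := h1.mapL T
  refine (h1.mapL S).unique (h2.congr_fun ?_)
  exact fun k => h k (ξ k)

/-- View `T` as a `κ × κ` matrix of operators on `K`. Commuting with every $s\otimes 1$ means that
each entry lies in $S'$, and `x` commutes with $S'$ entry by entry. -/
theorem amplify_commute_of_mem_bicommutant {κ : Type*} {S : Set (K →L[ℂ] K)} {x : K →L[ℂ] K}
    (hx : x ∈ Set.centralizer (Set.centralizer S))
    {T : lp (fun _ : κ => K) 2 →L[ℂ] lp (fun _ : κ => K) 2}
    (hT : ∀ s ∈ S, amplify κ s * T = T * amplify κ s) :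
    T * amplify κ x = amplify κ x * T := by
  classical
  have hsingle : ∀ (y : K →L[ℂ] K) (j : κ) (v : K),
      amplify κ y (lp.single 2 j v) = lp.single 2 j (y v) := by
    intro y j v
    refine lp.ext (funext fun k => ?_)
    rw [amplify_apply]
    by_cases h : k = j
    · subst h; simp
    · simp [h]
  have entry : ∀ i j, ∃ t : K →L[ℂ] K, ∀ v, t v = T (lp.single 2 j v) i := fun i j =>
    ⟨(lp.evalCLM ℂ (fun _ : κ => K) 2 i) ∘L T ∘L
      (lp.singleContinuousLinearMap ℂ (fun _ : κ => K) 2 j), fun v => rfl⟩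
  refine lp_hom_ext fun j v => lp.ext (funext fun i => ?_)
  obtain ⟨t, ht⟩ := entry i j
  have hmem : t ∈ Set.centralizer S := by
    intro s hs
    ext v
    have := congrArg (fun R => R (lp.single 2 j v) i) (hT s hs)
    simp only [mul_apply_eq_comp, amplify_apply, hsingle] at this
    simpa [ht] using this
  have := congrArg (fun R : K →L[ℂ] K => R v) (hx t hmem)
  simp only [mul_apply_eq_comp, ht] at this
  simpa only [mul_apply_eq_comp, hsingle, amplify_apply] using this

variable [CompleteSpace K]

theorem amplify_star {κ : Type*} (x : K →L[ℂ] K) :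
    star (amplify κ x) = amplify κ (star x) := by
  rw [ContinuousLinearMap.star_eq_adjoint]
  symm
  rw [ContinuousLinearMap.eq_adjoint_iff]
  intro ξ η
  simp only [lp.inner_eq_tsum, amplify_apply, ContinuousLinearMap.star_eq_adjoint,
    ContinuousLinearMap.adjoint_inner_left]

/-- The density part of von Neumann's bicommutant theorem, for the ultrastrong topology. -/
theorem amplify_mem_closure {κ : Type*} (S : StarSubalgebra ℂ (K →L[ℂ] K)) {x : K →L[ℂ] K}
    (hx : x ∈ Set.centralizer (Set.centralizer (S : Set (K →L[ℂ] K))))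
    (η : lp (fun _ : κ => K) 2) :
    amplify κ x η ∈ closure {ζ | ∃ s ∈ S, ζ = amplify κ s η} := by
  -- The orbit of `η` under `S`. The projection onto its closure will be shown to commute with the
  -- amplification of `S`, hence with that of `x`.
  let Y₀ : Submodule ℂ (lp (fun _ : κ => K) 2) :=
    { carrier := {ζ | ∃ s ∈ S, ζ = amplify κ s η}
      add_mem' := by
        rintro _ _ ⟨s, hs, rfl⟩ ⟨t, ht, rfl⟩
        exact ⟨s + t, add_mem hs ht, rfl⟩
      zero_mem' := ⟨0, zero_mem S, rfl⟩
      smul_mem' := by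
        rintro c _ ⟨s, hs, rfl⟩
        exact ⟨c • s, S.smul_mem hs c, rfl⟩ }
  let Y := Y₀.topologicalClosure
  have hinv : ∀ s ∈ S, ∀ ζ ∈ Y, amplify κ s ζ ∈ Y := by
    intro s hs ζ hζ
    refine map_mem_closure (amplify κ s).continuous hζ ?_
    rintro _ ⟨t, ht, rfl⟩
    exact ⟨s * t, mul_mem hs ht, rfl⟩
  -- Closure of `S` under adjoints makes the orthogonal complement invariant too, which is what lets
  -- the projection commute with `S`.
  have hinv' : ∀ s ∈ S, ∀ ζ ∈ Yᗮ, amplify κ s ζ ∈ Yᗮ := by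
    intro s hs ζ hζ
    rw [Submodule.mem_orthogonal] at hζ ⊢
    intro u hu
    rw [← ContinuousLinearMap.adjoint_inner_left, ← ContinuousLinearMap.star_eq_adjoint,
      amplify_star]
    exact hζ _ (hinv _ (star_mem hs) u hu)
  have : CompleteSpace Y := Y₀.isClosed_topologicalClosure.completeSpace_coe
  have hcomm : ∀ s ∈ (S : Set (K →L[ℂ] K)),
      amplify κ s * Y.starProjection = Y.starProjection * amplify κ s := by
    intro s hs
    ext1 ζ
    change amplify κ s (Y.starProjection ζ) = Y.starProjection (amplify κ s ζ)
    symm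
    refine Submodule.eq_starProjection_of_mem_orthogonal (hinv s hs _ (Y.starProjection_apply_mem ζ)) ?_
    rw [← map_sub]
    exact hinv' s hs _ (Y.sub_starProjection_mem_orthogonal ζ)
  -- Here `S` must be unital.
  have hη : η ∈ Y := subset_closure ⟨1, one_mem S, rfl⟩
  have h := congrArg (fun R => R η) (amplify_commute_of_mem_bicommutant hx hcomm)
  simp only [mul_apply_eq_comp, Submodule.starProjection_eq_self_iff.2 hη] at h
  exact (Submodule.starProjection_eq_self_iff.1 h : _ ∈ Y)

/-- Two normal functionals on a von Neumann algebra that agree on a unital `*`-subalgebra agree on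
its bicommutant. -/
theorem IsNormalFunctional.eq_of_eqOn {M : VonNeumannAlgebra K} {φ ψ : M.toStarSubalgebra → ℂ}
    (hφ : IsNormalFunctional M φ) (hψ : IsNormalFunctional M ψ)
    (S : StarSubalgebra ℂ (K →L[ℂ] K))
    (h : ∀ x : M.toStarSubalgebra, (x : K →L[ℂ] K) ∈ S → φ x = ψ x)
    (hSM : S ≤ M.toStarSubalgebra) {x : M.toStarSubalgebra}
    (hx : (x : K →L[ℂ] K) ∈ Set.centralizer (Set.centralizer (S : Set (K →L[ℂ] K)))) :
    φ x = ψ x := by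
  obtain ⟨ξ₁, η₁, h₁⟩ := hφ
  obtain ⟨ξ₂, η₂, h₂⟩ := hψ
  have glue : ∀ ζ₁ ζ₂ : lp (fun _ : ℕ => K) 2, Memℓp (Sum.elim (ζ₁ : ℕ → K) ζ₂) 2 := by
    intro ζ₁ ζ₂
    refine memℓp_gen (Summable.sum _ ?_ ?_)
    · exact (lp.memℓp ζ₁).summable (by norm_num)
    · exact (lp.memℓp ζ₂).summable (by norm_num)
  -- The sign on `ξ₂` makes the difference `φ - ψ` a single vector functional of the amplification
  -- over `ℕ ⊕ ℕ`. Its kernel is closed, so the density theorem applies.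
  let ξ : lp (fun _ : ℕ ⊕ ℕ => K) 2 := ⟨_, glue ξ₁ (-ξ₂)⟩
  let η : lp (fun _ : ℕ ⊕ ℕ => K) 2 := ⟨_, glue η₁ η₂⟩
  have key : ∀ y : M.toStarSubalgebra, ⟪ξ, amplify (ℕ ⊕ ℕ) (y : K →L[ℂ] K) η⟫_ℂ = φ y - ψ y := by
    intro y
    have hs := lp.summable_inner (𝕜 := ℂ) ξ (amplify (ℕ ⊕ ℕ) (y : K →L[ℂ] K) η)
    rw [h₁, h₂, lp.inner_eq_tsum, Summable.tsum_sum
      (hs.comp_injective Sum.inl_injective) (hs.comp_injective Sum.inr_injective),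
      sub_eq_add_neg, ← tsum_neg]
    congr 1
    refine tsum_congr fun n => ?_
    change ⟪(-ξ₂ : lp (fun _ : ℕ => K) 2) n, (y : K →L[ℂ] K) (η₂ n)⟫_ℂ = _
    rw [lp.coeFn_neg, Pi.neg_apply, inner_neg_left]
  have hcl : IsClosed {ζ | ⟪ξ, ζ⟫_ℂ = 0} := isClosed_eq (by fun_prop) continuous_const
  have hsub : {ζ | ∃ s ∈ S, ζ = amplify (ℕ ⊕ ℕ) s η} ⊆ {ζ | ⟪ξ, ζ⟫_ℂ = 0} := by
    rintro _ ⟨s, hs, rfl⟩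
    have := key ⟨s, hSM hs⟩
    rw [h _ hs, sub_self] at this
    exact this
  have h0 : ⟪ξ, amplify (ℕ ⊕ ℕ) (x : K →L[ℂ] K) η⟫_ℂ = 0 :=
    closure_minimal hsub hcl (amplify_mem_closure S hx η)
  rw [key, sub_eq_zero] at h0
  exact h0

theorem isNormalFunctional_inner (M : VonNeumannAlgebra K) (v w : K) :
    IsNormalFunctional M fun x => ⟪v, (x : K →L[ℂ] K) w⟫_ℂ := by
  refine ⟨lp.single 2 0 v, lp.single 2 0 w, fun x => ?_⟩
  rw [tsum_eq_single 0]
  · simp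
  · intro n hn
    simp [hn]

/-- Normal `*`-homomorphisms on the von Neumann algebra generated by `S` are determined by their
values on `S`. -/
theorem IsNormalMap.eq_of_eqOn {S : Set (K →L[ℂ] K)}
    {α β : (vonNeumannClosure S).toStarSubalgebra →⋆ₐ[ℂ] (vonNeumannClosure S).toStarSubalgebra}
    (hα : IsNormalMap (vonNeumannClosure S) α) (hβ : IsNormalMap (vonNeumannClosure S) β)
    (h : ∀ s (hs : s ∈ S), α ⟨s, subset_vonNeumannClosure S hs⟩ =
      β ⟨s, subset_vonNeumannClosure S hs⟩) : α = β := by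
  let M := vonNeumannClosure S
  -- The set where `α` and `β` agree, seen as operators on `K`: a unital `*`-subalgebra containing
  -- `S`, so its bicommutant contains all of `M`.
  let E : StarSubalgebra ℂ (K →L[ℂ] K) := (StarAlgHom.equalizer α β).map M.toStarSubalgebra.subtype
  have hE : ∀ x : M.toStarSubalgebra, (x : K →L[ℂ] K) ∈ E → α x = β x := by
    rintro x ⟨y, hy, hyx⟩
    rw [← Subtype.ext hyx]
    exact hy
  have hEM : E ≤ M.toStarSubalgebra := by
    rintro _ ⟨y, -, rfl⟩
    exact y.2
  have hSE : S ⊆ E := fun s hs => ⟨⟨s, subset_vonNeumannClosure S hs⟩, h s hs, rfl⟩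
  have hmem : ∀ x : M.toStarSubalgebra,
      (x : K →L[ℂ] K) ∈ Set.centralizer (Set.centralizer (E : Set (K →L[ℂ] K))) := by
    intro x
    have hx : (x : K →L[ℂ] K) ∈ StarSubalgebra.centralizer ℂ
      (StarSubalgebra.centralizer ℂ S : Set (K →L[ℂ] K)) := x.2
    rw [← SetLike.mem_coe, StarSubalgebra.coe_centralizer_centralizer] at hx
    refine Set.centralizer_subset (Set.centralizer_subset ?_) hx
    rintro s (hs | hs)
    · exact hSE hs
    · simpa using star_mem (hSE hs)
  ext x : 1
  -- Operators are separated by matrix coefficients, which are normal functionals and stay normal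
  -- after composition with `α` or `β`.
  refine Subtype.ext (ContinuousLinearMap.ext fun w => ext_inner_left ℂ fun v => ?_)
  exact (hα _ (isNormalFunctional_inner M v w)).eq_of_eqOn
    (hβ _ (isNormalFunctional_inner M v w)) E (fun y hy => by rw [hE y hy]) hEM (hmem x)

end Bicommutant

/-! ### Automorphisms implemented by a normalizing unitary -/

section UnitaryConjugation

variable {K : Type*} [NormedAddCommGroup K] [InnerProductSpace ℂ K] [CompleteSpace K]

/-- No continuity is needed, only commutants. If `y` commutes with `M`, then $W^*yW$ commutes with
`S` and its adjoints, hence with `x`; conjugating back, `y` commutes with $WxW^*$, which therefore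
lies in $M''=M$. -/
theorem conj_mem_of_generators {W : K →L[ℂ] K} (hW : W ∈ unitary (K →L[ℂ] K)) {S : Set (K →L[ℂ] K)}
    {M : VonNeumannAlgebra K} (h : ∀ s ∈ S, W * s * star W ∈ M)
    {x : K →L[ℂ] K} (hx : x ∈ vonNeumannClosure S) : W * x * star W ∈ M := by
  have hW₁ : star W * W = 1 := Unitary.star_mul_self_of_mem hW
  have hW₂ : W * star W = 1 := Unitary.mul_star_self_of_mem hW
  have hiff : ∀ s y : K →L[ℂ] K,
      W * s * star W * y = y * (W * s * star W) ↔ s * (star W * y * W) = star W * y * W * s := by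
    intro s y
    constructor <;> intro h
    · calc s * (star W * y * W) = star W * W * s * star W * y * W := by rw [hW₁]; noncomm_ring
        _ = star W * (W * s * star W * y) * W := by noncomm_ring
        _ = star W * y * W * s * (star W * W) := by rw [h]; noncomm_ring
        _ = _ := by rw [hW₁, mul_one]
    · calc W * s * star W * y = W * s * star W * y * (W * star W) := by rw [hW₂, mul_one]
        _ = W * (s * (star W * y * W)) * star W := by noncomm_ring
        _ = W * star W * y * (W * s * star W) := by rw [h]; noncomm_ring
        _ = _ := by rw [hW₂, one_mul]
  rw [← VonNeumannAlgebra.commutant_commutant M, VonNeumannAlgebra.mem_commutant_iff]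
  intro y hy
  have hcomm : ∀ z ∈ M, z * y = y * z := VonNeumannAlgebra.mem_commutant_iff.1 hy
  have hmem : star W * y * W ∈ StarSubalgebra.centralizer ℂ S := by
    rw [StarSubalgebra.mem_centralizer_iff]
    refine fun s hs => ⟨(hiff s y).1 (hcomm _ (h s hs)), (hiff _ y).1 (hcomm _ ?_)⟩
    have := star_mem (h s hs)
    rwa [star_mul, star_mul, star_star, ← mul_assoc] at this
  exact ((hiff x y).2 (((StarSubalgebra.mem_centralizer_iff ℂ).1 hx _ hmem).1).symm).symm

/-- The operator `W` is a unitary with `W M W* = M`. -/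
def Normalizes (W : K →L[ℂ] K) (M : VonNeumannAlgebra K) : Prop :=
  W ∈ unitary (K →L[ℂ] K) ∧ (∀ x ∈ M, W * x * star W ∈ M) ∧ ∀ x ∈ M, star W * x * W ∈ M

/-- The automorphism `x ↦ W x W*` of a von Neumann algebra `M` normalized by the unitary `W`. -/
def restrictConj (M : VonNeumannAlgebra K) {W : K →L[ℂ] K} (h : Normalizes W M) :
    M.toStarSubalgebra ≃⋆ₐ[ℂ] M.toStarSubalgebra where
  toFun x := ⟨W * x * star W, h.2.1 x x.2⟩
  invFun x := ⟨star W * x * W, h.2.2 x x.2⟩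
  left_inv x := Subtype.ext <| by
    change star W * (W * x * star W) * W = (x : K →L[ℂ] K)
    have : star W * (W * x * star W) * W = star W * W * x * (star W * W) := by noncomm_ring
    rw [this, Unitary.star_mul_self_of_mem h.1, one_mul, mul_one]
  right_inv x := Subtype.ext <| by
    change W * (star W * x * W) * star W = (x : K →L[ℂ] K)
    have : W * (star W * x * W) * star W = W * star W * x * (W * star W) := by noncomm_ring
    rw [this, Unitary.mul_star_self_of_mem h.1, one_mul, mul_one]
  map_mul' x y := Subtype.ext <| by
    change W * (x * y : K →L[ℂ] K) * star W = W * x * star W * (W * y * star W)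
    have : W * x * star W * (W * y * star W) = W * x * (star W * W) * y * star W := by noncomm_ring
    rw [this, Unitary.star_mul_self_of_mem h.1, mul_one, ← mul_assoc]
  map_add' x y := Subtype.ext <| by
    change W * (x + y : K →L[ℂ] K) * star W = W * x * star W + W * y * star W
    noncomm_ring
  map_star' x := Subtype.ext <| by
    change W * star (x : K →L[ℂ] K) * star W = star (W * x * star W)
    rw [star_mul, star_mul, star_star, mul_assoc]
  map_smul' c x := Subtype.ext <| by
    change W * (c • (x : K →L[ℂ] K)) * star W = c • (W * x * star W)
    rw [mul_smul_comm, smul_mul_assoc]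

theorem coe_restrictConj (M : VonNeumannAlgebra K) {W : K →L[ℂ] K} (h : Normalizes W M)
    (x : M.toStarSubalgebra) :
    (restrictConj M h x : K →L[ℂ] K) = W * x * star W := rfl

/-- The conjugation moves onto the vectors: $\langle\xi,WxW^*\eta\rangle=\langle
W^*\xi,x\,W^*\eta\rangle$, and the amplified $W^*$ preserves square-summability. -/
theorem isNormalMap_restrictConj (M : VonNeumannAlgebra K) {W : K →L[ℂ] K} (h : Normalizes W M) :
    IsNormalMap M (restrictConj M h) := by
  rintro φ ⟨ξ, η, hφ⟩
  refine ⟨amplify ℕ (star W) ξ, amplify ℕ (star W) η, fun x => ?_⟩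
  refine (hφ _).trans (tsum_congr fun n => ?_)
  rw [coe_restrictConj]
  change ⟪ξ n, W ((x : K →L[ℂ] K) (star W (η n)))⟫_ℂ =
    ⟪star W (ξ n), (x : K →L[ℂ] K) (star W (η n))⟫_ℂ
  rw [ContinuousLinearMap.star_eq_adjoint, ContinuousLinearMap.adjoint_inner_left]

theorem restrictConj_of_eq_one {M : VonNeumannAlgebra K} {W : K →L[ℂ] K} (h : Normalizes W M)
    (hW : W = 1) (x : M.toStarSubalgebra) : restrictConj M h x = x := by
  refine Subtype.ext ?_
  rw [coe_restrictConj, hW, star_one, one_mul, mul_one]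

theorem restrictConj_of_eq_mul {M : VonNeumannAlgebra K} {W W₁ W₂ : K →L[ℂ] K} (h : Normalizes W M)
    (h₁ : Normalizes W₁ M) (h₂ : Normalizes W₂ M) (hmul : W = W₁ * W₂)
    (x : M.toStarSubalgebra) :
    restrictConj M h x = restrictConj M h₁ (restrictConj M h₂ x) := by
  refine Subtype.ext ?_
  simp only [coe_restrictConj, hmul, star_mul, mul_assoc]

/-- If `W* Ω = Ω`, then the 2-norm of `W x W* - x` with respect to `Ω` is `‖W x Ω - x Ω‖`. -/
theorem sqrt_inner_restrictConj_sub {M : VonNeumannAlgebra K} {W : K →L[ℂ] K} (h : Normalizes W M)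
    {Ω : K} (hΩ : star W Ω = Ω) (x : M.toStarSubalgebra) :
    √(⟪Ω, ((star (restrictConj M h x - x) * (restrictConj M h x - x) :
      M.toStarSubalgebra) : K →L[ℂ] K) Ω⟫_ℂ).re =
      ‖W ((x : K →L[ℂ] K) Ω) - (x : K →L[ℂ] K) Ω‖ := by
  have hy : ((restrictConj M h x - x : M.toStarSubalgebra) : K →L[ℂ] K) Ω =
      W ((x : K →L[ℂ] K) Ω) - (x : K →L[ℂ] K) Ω := by
    change W ((x : K →L[ℂ] K) (star W Ω)) - (x : K →L[ℂ] K) Ω = _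
    rw [hΩ]
  rw [← hy]
  generalize restrictConj M h x - x = y
  rw [← Real.sqrt_sq (norm_nonneg ((y : K →L[ℂ] K) Ω)), ← inner_self_eq_norm_sq (𝕜 := ℂ),
    ← ContinuousLinearMap.adjoint_inner_right]
  rfl

theorem tendsto_sqrt_inner_restrictConj_sub {α : Type*} {l : Filter α} {M : VonNeumannAlgebra K}
    {W : α → (K →L[ℂ] K)} (h : ∀ a, Normalizes (W a) M) {Ω : K} (hΩ : ∀ a, star (W a) Ω = Ω)
    (hW : ∀ v, Tendsto (fun a => W a v) l (𝓝 v)) (x : M.toStarSubalgebra) :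
    Tendsto (fun a => √(⟪Ω, ((star (restrictConj M (h a) x - x) * (restrictConj M (h a) x - x) :
      M.toStarSubalgebra) : K →L[ℂ] K) Ω⟫_ℂ).re) l (𝓝 0) :=
  (tendsto_iff_norm_sub_tendsto_zero.1 (hW _)).congr fun a =>
    (sqrt_inner_restrictConj_sub (h a) (hΩ a) x).symm

end UnitaryConjugation

/-! ### Strong convergence of contractions -/

section Contractions

/-- A common Lipschitz bound gives equicontinuity. Strong convergence to the identity then needs
checking only on a dense set of vectors. -/
theorem isClosed_setOf_tendsto_self {K : Type*} [NormedAddCommGroup K] [NormedSpace ℂ K]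
    {α : Type*} {l : Filter α} {T : α → (K →L[ℂ] K)} (hT : ∀ a, ‖T a‖ ≤ 1) :
    IsClosed {v | Tendsto (fun a => T a v) l (𝓝 v)} := by
  have h : UniformEquicontinuous fun a => (T a : K → K) :=
    LipschitzWith.uniformEquicontinuous _ 1 fun a =>
      (T a).lipschitz.weaken (by exact_mod_cast hT a)
  exact h.equicontinuous.isClosed_setOfPred_tendsto continuous_id

theorem norm_le_one_of_mem_unitary {K : Type*} [NormedAddCommGroup K] [InnerProductSpace ℂ K]
    [CompleteSpace K] {W : K →L[ℂ] K} (hW : W ∈ unitary (K →L[ℂ] K)) : ‖W‖ ≤ 1 := by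
  rw [← mul_one W, CStarRing.norm_mem_unitary_mul _ hW]
  exact ContinuousLinearMap.norm_id_le

end Contractions

/-! ### Multiplication by the Gaussian unitaries -/

section Omega

variable {ι : Type*} {H : Type*} [NormedAddCommGroup H] [InnerProductSpace ℝ H]
  (e : HilbertBasis ι ℝ H)

theorem omega_zero : omega e (0 : H) =ᵐ[gaussianProduct ι] fun _ => 1 := by
  filter_upwards [omega_finset_sum e ∅ 0] with z hz
  simpa using hz

theorem norm_omega (ξ : H) : ∀ᵐ z ∂gaussianProduct ι, ‖omega e ξ z‖ = 1 := by
  filter_upwards [(memLp_omega e ξ).coeFn_toLp] with z hz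
  have : (√2 * Complex.I * gaussianField e ξ z : ℂ) =
      ((√2 * gaussianField e ξ z : ℝ) : ℂ) * Complex.I := by
    push_cast; ring
  rw [omega, hz, this, Complex.norm_exp_ofReal_mul_I]

theorem omega_smul (t : ℝ) (ξ : H) : omega e (t • ξ) =ᵐ[gaussianProduct ι]
    fun z => Complex.exp (√2 * Complex.I * (t * gaussianField e ξ z)) := by
  filter_upwards [(memLp_omega e (t • ξ)).coeFn_toLp, Lp.coeFn_smul t (gaussianField e ξ)]
    with z h1 h2
  rw [omega, h1, map_smul, h2]
  simp

/-- Both sides invert $\omega(\xi)$: one by additivity, the other because $|\omega(\xi)|=1$. -/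
theorem omega_neg (ξ : H) : omega e (-ξ) =ᵐ[gaussianProduct ι]
    fun z => starRingEnd ℂ (omega e ξ z) := by
  filter_upwards [omega_add e (-ξ) ξ, norm_omega e ξ, omega_zero e] with z h1 h2 h3
  rw [neg_add_cancel, h3] at h1
  have h4 : omega e ξ z * starRingEnd ℂ (omega e ξ z) = 1 := by
    rw [Complex.mul_conj, Complex.normSq_eq_norm_sq, h2]; simp
  calc omega e (-ξ) z = omega e (-ξ) z * (omega e ξ z * starRingEnd ℂ (omega e ξ z)) := by
        rw [h4, mul_one]
    _ = _ := by rw [← mul_assoc, ← h1, one_mul]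

theorem mulOp_omega_add (ξ η : H) : mulOp (gaussianProduct ι) (omega e (ξ + η)) =
    mulOp (gaussianProduct ι) (omega e ξ) * mulOp (gaussianProduct ι) (omega e η) := by
  ext1 ψ
  refine Lp.ext ?_
  filter_upwards [mulOp_apply (gaussianProduct ι) (omega e (ξ + η)) ψ, omega_add e ξ η,
    mulOp_apply (gaussianProduct ι) (omega e ξ) (mulOp (gaussianProduct ι) (omega e η) ψ),
    mulOp_apply (gaussianProduct ι) (omega e η) ψ] with z h1 h2 h3 h4
  rw [h1, h2, mul_apply_eq_comp, h3, h4, mul_assoc]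

theorem mulOp_omega_zero : mulOp (gaussianProduct ι) (omega e (0 : H)) = 1 := by
  ext1 ψ
  refine Lp.ext ?_
  filter_upwards [mulOp_apply (gaussianProduct ι) (omega e (0 : H)) ψ, omega_zero e] with z h1 h2
  rw [h1, h2, one_mul]
  rfl

theorem star_mulOp_omega (ξ : H) : star (mulOp (gaussianProduct ι) (omega e ξ)) =
    mulOp (gaussianProduct ι) (omega e (-ξ)) := by
  rw [ContinuousLinearMap.star_eq_adjoint]
  symm
  rw [ContinuousLinearMap.eq_adjoint_iff]
  intro ψ φ
  rw [L2.inner_def, L2.inner_def]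
  refine integral_congr_ae ?_
  filter_upwards [mulOp_apply (gaussianProduct ι) (omega e (-ξ)) ψ, omega_neg e ξ,
    mulOp_apply (gaussianProduct ι) (omega e ξ) φ] with z h1 h2 h3
  rw [h1, h2, h3]
  simp [mul_comm, mul_left_comm]

/-- Dominated convergence: $|e^{i\theta}-1|\le 2$ bounds the squared integrand by $4|\psi|^2$, which
is integrable. -/
theorem tendsto_mulOp_omega_smul (ξ : H) (ψ : Lp ℂ 2 (gaussianProduct ι)) :
    Tendsto (fun t : ℝ => mulOp (gaussianProduct ι) (omega e (t • ξ)) ψ) (𝓝 0) (𝓝 ψ) := by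
  -- A representative of the difference, chosen simultaneously for all `t`, so that for each fixed
  -- `z` it is continuous in `t` and vanishes at `t = 0`. The classes in `Lp` are determined only up
  -- to null sets depending on `t`.
  let F : ℝ → (ι → ℝ) → ℂ := fun t z =>
    (Complex.exp (√2 * Complex.I * (t * gaussianField e ξ z)) - 1) * ψ z
  have hF : ∀ t, (mulOp (gaussianProduct ι) (omega e (t • ξ)) ψ - ψ : Lp ℂ 2 (gaussianProduct ι))
      =ᵐ[gaussianProduct ι] F t := by
    intro t
    filter_upwards [Lp.coeFn_sub (mulOp (gaussianProduct ι) (omega e (t • ξ)) ψ) ψ,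
      mulOp_apply (gaussianProduct ι) (omega e (t • ξ)) ψ, omega_smul e t ξ] with z h1 h2 h3
    rw [h1, Pi.sub_apply, h2, h3]
    simp only [F]
    ring
  have hmeas : ∀ t, AEStronglyMeasurable (F t) (gaussianProduct ι) := fun t =>
    (Lp.aestronglyMeasurable _).congr (hF t)
  have hbound : ∀ t z, ‖F t z‖ ≤ 2 * ‖ψ z‖ := by
    intro t z
    rw [norm_mul]
    refine mul_le_mul_of_nonneg_right ?_ (norm_nonneg _)
    refine (norm_sub_le _ _).trans ?_
    have : (√2 * Complex.I * (t * gaussianField e ξ z) : ℂ) =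
        ((√2 * (t * gaussianField e ξ z) : ℝ) : ℂ) * Complex.I := by
      push_cast; ring
    rw [this, Complex.norm_exp_ofReal_mul_I, norm_one]
    norm_num
  have hsq : ∀ t, ‖mulOp (gaussianProduct ι) (omega e (t • ξ)) ψ - ψ‖ ^ 2 =
      ∫ z, ‖F t z‖ ^ 2 ∂gaussianProduct ι := by
    intro t
    rw [← inner_self_eq_norm_sq (𝕜 := ℂ), L2.inner_def]
    have h1 : ∫ z, ⟪(mulOp (gaussianProduct ι) (omega e (t • ξ)) ψ - ψ :
        Lp ℂ 2 (gaussianProduct ι)) z, (mulOp (gaussianProduct ι) (omega e (t • ξ)) ψ - ψ :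
        Lp ℂ 2 (gaussianProduct ι)) z⟫_ℂ ∂gaussianProduct ι =
        ∫ z, ((‖F t z‖ ^ 2 : ℝ) : ℂ) ∂gaussianProduct ι := by
      refine integral_congr_ae ?_
      filter_upwards [hF t] with z hz
      rw [hz, inner_self_eq_norm_sq_to_K]
      push_cast
      rfl
    rw [h1, integral_complex_ofReal]
    rfl
  have hlim : Tendsto (fun t => ∫ z, ‖F t z‖ ^ 2 ∂gaussianProduct ι) (𝓝 0)
      (𝓝 (∫ z, (0 : ℝ) ∂gaussianProduct ι)) := by
    refine tendsto_integral_filter_of_dominated_convergence (fun z => (2 * ‖ψ z‖) ^ 2)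
      (Eventually.of_forall fun t => (hmeas t).norm.pow 2)
      (Eventually.of_forall fun t => Eventually.of_forall fun z => ?_) ?_
      (Eventually.of_forall fun z => ?_)
    · rw [norm_pow, norm_norm]
      exact pow_le_pow_left₀ (norm_nonneg _) (hbound t z) 2
    · simp_rw [mul_pow]
      exact ((Lp.memLp ψ).integrable_norm_pow (by norm_num)).const_mul _
    · have hc : Continuous fun t : ℝ => ‖F t z‖ ^ 2 := by fun_prop
      simpa [F] using hc.tendsto 0
  simp_rw [← hsq, integral_zero] at hlim
  rw [tendsto_iff_norm_sub_tendsto_zero]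
  simpa using hlim.sqrt

end Omega

/-! ### The unitaries $\omega(\xi)\otimes 1$ -/

section Phase

variable {ι : Type*} {H : Type*} [NormedAddCommGroup H] [InnerProductSpace ℝ H]
  (e : HilbertBasis ι ℝ H) {F : Type*} [NormedAddCommGroup F] [InnerProductSpace ℂ F]

/-- The operator `ω(ξ) ⊗ 1`. -/
def phaseOp (F : Type*) [NormedAddCommGroup F] [InnerProductSpace ℂ F] (ξ : H) :
    HilbertTensor (Lp ℂ 2 (gaussianProduct ι)) F →L[ℂ]
      HilbertTensor (Lp ℂ 2 (gaussianProduct ι)) F :=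
  opTensor (mulOp (gaussianProduct ι) (omega e ξ)) 1

theorem phaseOp_add (ξ η : H) : phaseOp e F (ξ + η) = phaseOp e F ξ * phaseOp e F η := by
  rw [phaseOp, phaseOp, phaseOp, ← opTensor_mul, mulOp_omega_add, one_mul]

theorem phaseOp_zero : phaseOp e F (0 : H) = 1 := by
  rw [phaseOp, mulOp_omega_zero, opTensor_one]

variable [CompleteSpace F]

theorem star_phaseOp (ξ : H) : star (phaseOp e F ξ) = phaseOp e F (-ξ) := by
  rw [phaseOp, opTensor_star, star_mulOp_omega, star_one, phaseOp]

theorem phaseOp_mem_unitary (ξ : H) : phaseOp e F ξ ∈ unitary (_ →L[ℂ] _) := by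
  rw [Unitary.mem_iff, star_phaseOp, ← phaseOp_add, ← phaseOp_add, neg_add_cancel, add_neg_cancel,
    phaseOp_zero]
  exact ⟨rfl, rfl⟩

theorem norm_phaseOp_le (ξ : H) : ‖phaseOp e F ξ‖ ≤ 1 :=
  norm_le_one_of_mem_unitary (phaseOp_mem_unitary e ξ)

/-- The uniform norm bound and linearity reduce this to elementary tensors, where only the first leg
moves. -/
theorem tendsto_phaseOp_smul (ξ : H) (v : HilbertTensor (Lp ℂ 2 (gaussianProduct ι)) F) :
    Tendsto (fun t : ℝ => phaseOp e F (t • ξ) v) (𝓝 0) (𝓝 v) := by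
  induction v using UniformSpace.Completion.induction_on with
  | hp => exact isClosed_setOf_tendsto_self fun t : ℝ => norm_phaseOp_le e (t • ξ)
  | ih v =>
    induction v using TensorProduct.induction_on with
    | zero => simp only [UniformSpace.Completion.coe_zero, map_zero, tendsto_const_nhds]
    | add a b ha hb =>
      simp only [UniformSpace.Completion.coe_add, map_add]
      exact ha.add hb
    | tmul a b =>
      simp only [phaseOp, opTensor_tmul, one_apply_eq_self]
      have hc : Continuous fun a : Lp ℂ 2 (gaussianProduct ι) =>
          ((a ⊗ₜ[ℂ] b : _ ⊗[ℂ] F) : HilbertTensor (Lp ℂ 2 (gaussianProduct ι)) F) := by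
        refine (UniformSpace.Completion.continuous_coe _).comp ?_
        refine AddMonoidHomClass.continuous_of_bound
          ((TensorProduct.mk ℂ (Lp ℂ 2 (gaussianProduct ι)) F).flip b) ‖b‖ fun a => ?_
        simp [TensorProduct.norm_tmul, mul_comm]
      exact (hc.tendsto a).comp (tendsto_mulOp_omega_smul e ξ a)

end Phase

/-! ### Adjoints of diagonal operators and multiplicativity of the action -/

section Diagonal

variable {Γ : Type*} {K : Type*} [NormedAddCommGroup K] [InnerProductSpace ℂ K] [CompleteSpace K]

theorem star_diagOp (T : Γ → (K →L[ℂ] K)) (C C' : ℝ) (hT : ∀ h, ‖T h‖ ≤ C)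
    (hT' : ∀ h, ‖star (T h)‖ ≤ C') :
    star (diagOp T C hT) = diagOp (fun h => star (T h)) C' hT' := by
  rw [ContinuousLinearMap.star_eq_adjoint]
  symm
  rw [ContinuousLinearMap.eq_adjoint_iff]
  intro ξ η
  simp only [lp.inner_eq_tsum, diagOp_apply, ContinuousLinearMap.star_eq_adjoint,
    ContinuousLinearMap.adjoint_inner_left]

variable [Group Γ] (U : Γ →* unitary (K →L[ℂ] K))

theorem conj_mul (g : Γ) (x y : K →L[ℂ] K) : conj U g (x * y) = conj U g x * conj U g y := by
  have h : conj U g x * conj U g y = (U g : K →L[ℂ] K) * x *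
      (star (U g : K →L[ℂ] K) * U g) * y * star (U g : K →L[ℂ] K) := by
    unfold conj
    noncomm_ring
  rw [h, Unitary.star_mul_self_of_mem (U g).2, mul_one, conj]
  noncomm_ring

end Diagonal

section UnitaryOperators

variable {K : Type*} [NormedAddCommGroup K] [InnerProductSpace ℂ K] [CompleteSpace K]
  {W V A B : K →L[ℂ] K}

theorem mem_unitary_of_star_eq (h : star W = V) (h₁ : V * W = 1) (h₂ : W * V = 1) :
    W ∈ unitary (K →L[ℂ] K) := by
  rw [Unitary.mem_iff, h]
  exact ⟨h₁, h₂⟩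

theorem conj_eq_of_mul_eq_mul (hW : W ∈ unitary (K →L[ℂ] K)) (h : W * A = B * W) :
    W * A * star W = B := by
  rw [h, mul_assoc, Unitary.mul_star_self_of_mem hW, mul_one]

theorem star_mul_eq_mul_star (h : A * star V = star V * A) : star A * V = V * star A := by
  have := congrArg star h
  rw [star_mul, star_mul, star_star] at this
  exact this.symm

end UnitaryOperators

/-! ### The implementing unitary and the deformation -/

section Implementation

/-- The Hilbert space `ℓ²(Γ, L²(Z, ν) ⊗ L²(X, μ))` on which `M̃` acts. -/
abbrev CrossedSpace (Γ ι : Type*) {X : Type*} [MeasurableSpace X] (μ : Measure X) : Type _ :=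
  lp (fun _ : Γ => HilbertTensor (Lp ℂ 2 (gaussianProduct ι)) (Lp ℂ 2 μ)) 2

variable {Γ : Type*} [Group Γ] {X : Type*} [MeasurableSpace X] (μ : Measure X)
  {ι : Type*} {H : Type*} [NormedAddCommGroup H] [InnerProductSpace ℝ H]
  (e : HilbertBasis ι ℝ H)

/-- The $\omega(\xi)$ commute with one another and form a family closed under adjoints, so they
commute with their bicommutant $D$. Thus $\omega(\xi)\otimes 1$ commutes with the generators
$d\otimes y$ and with what they generate. -/
theorem phaseOp_mul_comm_of_mem_baseAlgebra (ξ : H)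
    {x : HilbertTensor (Lp ℂ 2 (gaussianProduct ι)) (Lp ℂ 2 μ) →L[ℂ]
      HilbertTensor (Lp ℂ 2 (gaussianProduct ι)) (Lp ℂ 2 μ)} (hx : x ∈ baseAlgebra μ e) :
    phaseOp e (Lp ℂ 2 μ) ξ * x = x * phaseOp e (Lp ℂ 2 μ) ξ := by
  have hD : ∀ d ∈ gaussianAlgebra e, ∀ ξ : H, d * mulOp (gaussianProduct ι) (omega e ξ) =
      mulOp (gaussianProduct ι) (omega e ξ) * d := by
    intro d hd ξ
    refine (((StarSubalgebra.mem_centralizer_iff ℂ).1 hd _ ?_).1).symm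
    rw [SetLike.mem_coe, StarSubalgebra.mem_centralizer_iff]
    rintro _ ⟨η, rfl⟩
    simp only [star_mulOp_omega, ← mulOp_omega_add, add_comm, true_and]
  have hgen : ∀ ξ : H, ∀ z ∈ {z | ∃ x ∈ gaussianAlgebra e, ∃ y ∈ linftyAlgebra μ, z = opTensor x y},
      z * phaseOp e (Lp ℂ 2 μ) ξ = phaseOp e (Lp ℂ 2 μ) ξ * z := by
    rintro ξ _ ⟨d, hd, y, -, rfl⟩
    rw [phaseOp, ← opTensor_mul, ← opTensor_mul, hD d hd, one_mul, mul_one]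
  refine ((StarSubalgebra.mem_centralizer_iff ℂ).1 hx _ ?_).1
  rw [SetLike.mem_coe, StarSubalgebra.mem_centralizer_iff]
  refine fun z hz => ⟨hgen ξ z hz, ?_⟩
  -- Commutation with the adjoint of `z` is the adjoint of commutation of `z` with the phase at
  -- `-ξ`.
  exact star_mul_eq_mul_star (by rw [star_phaseOp, hgen (-ξ) z hz])

/-- The diagonal unitary `(W_t ξ)(h) = (ω(-t b(h⁻¹)) ⊗ 1) ξ(h)` on `ℓ²(Γ, L²(Z, ν) ⊗ L²(X, μ))`, which
implements the deformation. -/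
def deformationUnitary (b : Γ → H) (t : ℝ) :
    CrossedSpace Γ ι μ →L[ℂ] CrossedSpace Γ ι μ :=
  diagOp (fun h => phaseOp e (Lp ℂ 2 μ) (-(t • b h⁻¹))) 1 fun _ => norm_phaseOp_le e _

theorem deformationUnitary_apply (b : Γ → H) (t : ℝ)
    (ξ : CrossedSpace Γ ι μ) (h : Γ) :
    deformationUnitary μ e b t ξ h = phaseOp e (Lp ℂ 2 μ) (-(t • b h⁻¹)) (ξ h) := rfl

theorem deformationUnitary_add (b : Γ → H) (s t : ℝ) :
    deformationUnitary μ e b (s + t) = deformationUnitary μ e b s * deformationUnitary μ e b t := by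
  refine ContinuousLinearMap.ext fun ξ => lp.ext (funext fun h => ?_)
  rw [mul_apply_eq_comp]
  simp only [deformationUnitary_apply]
  rw [add_smul, neg_add, phaseOp_add, mul_apply_eq_comp]

theorem deformationUnitary_zero (b : Γ → H) : deformationUnitary μ e b 0 = 1 := by
  refine ContinuousLinearMap.ext fun ξ => lp.ext (funext fun h => ?_)
  rw [deformationUnitary_apply, zero_smul, neg_zero, phaseOp_zero]
  rfl

theorem star_deformationUnitary (b : Γ → H) (t : ℝ) :
    star (deformationUnitary μ e b t) = deformationUnitary μ e b (-t) := by
  have h : ∀ h : Γ, star (phaseOp e (Lp ℂ 2 μ) (-(t • b h⁻¹))) =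
      phaseOp e (Lp ℂ 2 μ) (-(-t • b h⁻¹)) := fun h => by rw [star_phaseOp, neg_smul]
  refine (star_diagOp _ 1 1 _ fun g => ?_).trans ?_
  · rw [h]
    exact norm_phaseOp_le e _
  · simp only [h]
    rfl

theorem deformationUnitary_mem_unitary (b : Γ → H) (t : ℝ) :
    deformationUnitary μ e b t ∈ unitary (CrossedSpace Γ ι μ →L[ℂ] CrossedSpace Γ ι μ) :=
  mem_unitary_of_star_eq (star_deformationUnitary μ e b t)
    (by rw [← deformationUnitary_add, neg_add_cancel, deformationUnitary_zero])
    (by rw [← deformationUnitary_add, add_neg_cancel, deformationUnitary_zero])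

theorem norm_deformationUnitary_le (b : Γ → H) (t : ℝ) : ‖deformationUnitary μ e b t‖ ≤ 1 :=
  norm_le_one_of_mem_unitary (deformationUnitary_mem_unitary μ e b t)

/-- No uniformity over `Γ` is available, since `b` may be unbounded. The $W_t$ are contractions, so
finitely supported vectors suffice, and there the convergence is that of finitely many phases. -/
theorem tendsto_deformationUnitary (b : Γ → H)
    (ξ : CrossedSpace Γ ι μ) :
    Tendsto (fun t : ℝ => deformationUnitary μ e b t ξ) (𝓝 0) (𝓝 ξ) := by
  classical
  have hcl := isClosed_setOf_tendsto_self (l := 𝓝 (0 : ℝ)) fun t : ℝ =>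
    norm_deformationUnitary_le μ e b t
  refine hcl.mem_of_tendsto (lp.hasSum_single (by norm_num) ξ)
    (Eventually.of_forall fun s => ?_)
  simp only [Set.mem_ofPred_eq, map_sum]
  refine tendsto_finsetSum s fun h _ => ?_
  have hs : ∀ t : ℝ, deformationUnitary μ e b t (lp.single 2 h (ξ h)) =
      lp.single 2 h (phaseOp e (Lp ℂ 2 μ) (t • (-b h⁻¹)) (ξ h)) := by
    intro t
    refine lp.ext (funext fun k => ?_)
    rw [deformationUnitary_apply, smul_neg]
    by_cases hk : k = h
    · subst hk; simp
    · simp [hk]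
  simp_rw [hs]
  exact ((lp.singleContinuousLinearMap ℂ
    (fun _ : Γ => HilbertTensor (Lp ℂ 2 (gaussianProduct ι)) (Lp ℂ 2 μ)) 2 h).continuous.tendsto
      _).comp (tendsto_phaseOp_smul e _ (ξ h))

theorem cocycle_one {G : Type*} [Group G] {π : G →* (H ≃ₗᵢ[ℝ] H)} {b : G → H}
    (hb : ∀ g h : G, b (g * h) = π g (b h) + b g) : b 1 = 0 := by
  simpa using hb 1 1

/-- The phase at the identity of `Γ` is $\omega(0)=1$. In particular the trace vector $\Omega$ is
fixed. -/
theorem star_deformationUnitary_single_one [DecidableEq Γ] {b : Γ → H} (hb : b 1 = 0) (t : ℝ)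
    (v : HilbertTensor (Lp ℂ 2 (gaussianProduct ι)) (Lp ℂ 2 μ)) :
    star (deformationUnitary μ e b t) (lp.single 2 1 v) = lp.single 2 1 v := by
  refine lp.ext (funext fun k => ?_)
  rw [star_deformationUnitary, deformationUnitary_apply]
  by_cases hk : k = 1
  · subst hk
    rw [inv_one, hb, smul_zero, neg_zero, phaseOp_zero]
    rfl
  · simp [hk]

variable [MulAction Γ X] [MeasurableConstSMul Γ X] [SMulInvariantMeasure Γ X μ]
  [Countable ι] (π : Γ →* (H ≃ₗᵢ[ℝ] H))

theorem conj_diagonalRep_phaseOp (g : Γ) (ξ : H) :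
    conj (diagonalRep μ e π) g (phaseOp e (Lp ℂ 2 μ) ξ) = phaseOp e (Lp ℂ 2 μ) (π g ξ) := by
  rw [phaseOp, phaseOp, ← conj_gaussianRep_omega]
  change opTensor _ _ * opTensor _ _ * star (opTensor _ _) = _
  rw [opTensor_star, ← opTensor_mul, ← opTensor_mul, mul_one,
    Unitary.mul_star_self_of_mem (actionRep μ g).2]
  rfl

theorem deformationUnitary_mul_crossedRep (b : Γ → H) (t : ℝ)
    {x : HilbertTensor (Lp ℂ 2 (gaussianProduct ι)) (Lp ℂ 2 μ) →L[ℂ]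
      HilbertTensor (Lp ℂ 2 (gaussianProduct ι)) (Lp ℂ 2 μ)} (hx : x ∈ baseAlgebra μ e) :
    deformationUnitary μ e b t * crossedRep (diagonalRep μ e π) x =
      crossedRep (diagonalRep μ e π) x * deformationUnitary μ e b t := by
  refine ContinuousLinearMap.ext fun ξ => lp.ext (funext fun h => ?_)
  have key : ∀ η : H, phaseOp e (Lp ℂ 2 μ) η * conj (diagonalRep μ e π) h⁻¹ x =
      conj (diagonalRep μ e π) h⁻¹ x * phaseOp e (Lp ℂ 2 μ) η := by
    intro η
    -- This writes the phase as $\sigma_{h^{-1}}$ of another phase. Commutation with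
    -- $\sigma_{h^{-1}}(x)$ then follows from commutation with `x`, without showing that $\sigma$
    -- preserves $D\bar\otimes A$.
    have hη : η = π h⁻¹ (π h η) := by
      change η = (π h⁻¹ * π h) η
      rw [← map_mul, inv_mul_cancel, map_one]
      rfl
    rw [hη, ← conj_diagonalRep_phaseOp, ← conj_mul, ← conj_mul,
      phaseOp_mul_comm_of_mem_baseAlgebra μ e _ hx]
  exact congrArg (fun R => R (ξ h)) (key _)

/-- The only use of the full cocycle identity. At the coordinate `h`,
$b(h^{-1}g)=\pi(h^{-1})b(g)+b(h^{-1})$ gives $-t\,b(h^{-1})=t\,\pi(h^{-1})b(g)-t\,b(h^{-1}g)$,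
matching the phases on the two sides. -/
theorem deformationUnitary_mul_leftShift {b : Γ → H}
    (hb : ∀ g h : Γ, b (g * h) = π g (b h) + b g) (t : ℝ) (g : Γ) :
    deformationUnitary μ e b t * leftShift g =
      crossedRep (diagonalRep μ e π) (phaseOp e (Lp ℂ 2 μ) (t • b g)) * leftShift g *
        deformationUnitary μ e b t := by
  refine ContinuousLinearMap.ext fun ξ => lp.ext (funext fun h => ?_)
  change phaseOp e (Lp ℂ 2 μ) (-(t • b h⁻¹)) (ξ (g⁻¹ * h)) =
    conj (diagonalRep μ e π) h⁻¹ (phaseOp e (Lp ℂ 2 μ) (t • b g))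
      (phaseOp e (Lp ℂ 2 μ) (-(t • b (g⁻¹ * h)⁻¹)) (ξ (g⁻¹ * h)))
  rw [conj_diagonalRep_phaseOp, ← mul_apply_eq_comp, ← phaseOp_add, mul_inv_rev, inv_inv, hb]
  congr 2
  simp

theorem deformationUnitary_conj_crossedRep (b : Γ → H) (t : ℝ)
    {x : HilbertTensor (Lp ℂ 2 (gaussianProduct ι)) (Lp ℂ 2 μ) →L[ℂ]
      HilbertTensor (Lp ℂ 2 (gaussianProduct ι)) (Lp ℂ 2 μ)} (hx : x ∈ baseAlgebra μ e) :
    deformationUnitary μ e b t * crossedRep (diagonalRep μ e π) x *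
      star (deformationUnitary μ e b t) = crossedRep (diagonalRep μ e π) x :=
  conj_eq_of_mul_eq_mul (deformationUnitary_mem_unitary μ e b t)
    (deformationUnitary_mul_crossedRep μ e π b t hx)

theorem deformationUnitary_conj_leftShift {b : Γ → H}
    (hb : ∀ g h : Γ, b (g * h) = π g (b h) + b g) (t : ℝ) (g : Γ) :
    deformationUnitary μ e b t * leftShift g * star (deformationUnitary μ e b t) =
      crossedRep (diagonalRep μ e π) (phaseOp e (Lp ℂ 2 μ) (t • b g)) * leftShift g :=
  conj_eq_of_mul_eq_mul (deformationUnitary_mem_unitary μ e b t)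
    (deformationUnitary_mul_leftShift μ e π hb t g)

theorem normalizes_deformationUnitary {b : Γ → H}
    (hb : ∀ g h : Γ, b (g * h) = π g (b h) + b g) (t : ℝ) :
    Normalizes (deformationUnitary μ e b t) (tildeM μ e π) := by
  have h : ∀ t : ℝ, ∀ x ∈ tildeM μ e π,
      deformationUnitary μ e b t * x * star (deformationUnitary μ e b t) ∈ tildeM μ e π := by
    intro t x hx
    refine conj_mem_of_generators (deformationUnitary_mem_unitary μ e b t) ?_ hx
    rintro _ (⟨y, hy, rfl⟩ | ⟨g, rfl⟩)
    · rw [deformationUnitary_conj_crossedRep μ e π b t hy]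
      exact (baseIncl μ e π ⟨y, hy⟩).2
    · rw [deformationUnitary_conj_leftShift μ e π hb]
      exact (baseIncl μ e π (omegaTensorOne μ e (t • b g)) * canonicalUnitary μ e π g).2
  refine ⟨deformationUnitary_mem_unitary μ e b t, h t, fun x hx => ?_⟩
  -- Invariance under $W_t^*\,\cdot\,W_t$ is the inclusion already proved, at time `-t`.
  simpa only [star_deformationUnitary, neg_neg] using h (-t) x hx

/-- The deformation `α_t = Ad W_t` of `M̃`. -/
def deformation {b : Γ → H} (hb : ∀ g h : Γ, b (g * h) = π g (b h) + b g) (t : ℝ) :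
    TildeM μ e π ≃⋆ₐ[ℂ] TildeM μ e π :=
  restrictConj (tildeM μ e π) (normalizes_deformationUnitary μ e π hb t)

theorem isDeformation_deformation {b : Γ → H} (hb : ∀ g h : Γ, b (g * h) = π g (b h) + b g)
    (t : ℝ) : IsDeformation μ e π b t (deformation μ e π hb t) :=
  ⟨isNormalMap_restrictConj _ (normalizes_deformationUnitary μ e π hb t),
    fun x => Subtype.ext (deformationUnitary_conj_crossedRep μ e π b t x.2),
    fun g => Subtype.ext (deformationUnitary_conj_leftShift μ e π hb t g)⟩

theorem IsDeformation.unique {b : Γ → H} {t : ℝ} {α β : TildeM μ e π →⋆ₐ[ℂ] TildeM μ e π}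
    (hα : IsDeformation μ e π b t α) (hβ : IsDeformation μ e π b t β) : α = β := by
  refine IsNormalMap.eq_of_eqOn hα.1 hβ.1 ?_
  rintro _ (⟨y, hy, rfl⟩ | ⟨g, rfl⟩)
  · exact (hα.2.1 ⟨y, hy⟩).trans (hβ.2.1 ⟨y, hy⟩).symm
  · exact (hα.2.2 g).trans (hβ.2.2 g).symm

end Implementation

end CocycleDeformation
end

theorem proposition3p3 {Γ : Type*} [Group Γ]
    {X : Type*} [MeasurableSpace X] (μ : Measure X) [IsProbabilityMeasure μ]
    [MulAction Γ X] [MeasurableConstSMul Γ X] [SMulInvariantMeasure Γ X μ]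
    {H : Type*} [NormedAddCommGroup H] [InnerProductSpace ℝ H]
    {ι : Type*} [Countable ι] (e : HilbertBasis ι ℝ H)
    (π : Γ →* (H ≃ₗᵢ[ℝ] H)) (b : Γ → H) (hb : ∀ g h : Γ, b (g * h) = π g (b h) + b g) :
    ∃ α : ℝ → (CocycleDeformation.TildeM μ e π ≃⋆ₐ[ℂ] CocycleDeformation.TildeM μ e π),
      (∀ t : ℝ,
        CocycleDeformation.IsDeformation μ e π b t (α t) ∧
        ∀ β : CocycleDeformation.TildeM μ e π →⋆ₐ[ℂ] CocycleDeformation.TildeM μ e π,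
          CocycleDeformation.IsDeformation μ e π b t β → ∀ x, β x = α t x) ∧
      (∀ x, α 0 x = x) ∧
      (∀ (s t : ℝ) (x : CocycleDeformation.TildeM μ e π), α (s + t) x = α s (α t x)) ∧
      ∀ x : CocycleDeformation.TildeM μ e π,
        Tendsto (fun t : ℝ => CocycleDeformation.twoNorm μ e π (α t x - x)) (𝓝 0) (𝓝 0) := by
  classical
  refine ⟨CocycleDeformation.deformation μ e π hb, fun t =>
    ⟨CocycleDeformation.isDeformation_deformation μ e π hb t, fun β hβ x => ?_⟩, fun x => ?_,
    -- Unfolding `twoNorm` and `trace` gives exactly the square root in this lemma, with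
    -- $\Omega=\delta_1\otimes(1\otimes 1)$.
    fun s t x => ?_, CocycleDeformation.tendsto_sqrt_inner_restrictConj_sub
      (CocycleDeformation.normalizes_deformationUnitary μ e π hb)
      (fun t => CocycleDeformation.star_deformationUnitary_single_one μ e
        (CocycleDeformation.cocycle_one hb) t _)
      (CocycleDeformation.tendsto_deformationUnitary μ e b)⟩
  · have h : β = (CocycleDeformation.deformation μ e π hb t).toStarAlgHom :=
      hβ.unique μ e π (CocycleDeformation.isDeformation_deformation μ e π hb t)
    rw [h]
    rfl
  · exact CocycleDeformation.restrictConj_of_eq_one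
      (CocycleDeformation.normalizes_deformationUnitary μ e π hb 0)
      (CocycleDeformation.deformationUnitary_zero μ e b) x
  · exact CocycleDeformation.restrictConj_of_eq_mul
      (CocycleDeformation.normalizes_deformationUnitary μ e π hb (s + t))
      (CocycleDeformation.normalizes_deformationUnitary μ e π hb s)
      (CocycleDeformation.normalizes_deformationUnitary μ e π hb t)
      (CocycleDeformation.deformationUnitary_add μ e b s t) x
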